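/- Let $k$ be a field of characteristic zero. A variety over $k$ is a reduced separated scheme of finite type over $k$. Let $K_0(\mathrm{Var}/k)$ be the Grothendieck ring of varieties over $k$: the commutative ring generated by the isomorphism classes $[X]$ of varieties $X$ over $k$, subject to the relations $[X]=[Z]+[U]$ whenever $Z\subset X$ is a closed subvariety with open complement $U$, with product given by $[X][Y]=[X\times_k Y]$ and unit $1=[\operatorname{Spec} k]$. Put $\mathbb L=[\mathbb A^1_k]$. Two varieties $X,Y$ are called L-equivalent if $[X]-[Y]$ vanishes in the localization $K_0(\mathrm{Var}/k)[\mathbb L^{-1}]$. For an ordered $8$-tuple $\mathbf p=(p_1,\dots,p_8)$ of distinct $k$-rational points of $\mathbb P^3_k$, let $X_{\mathbf p}$ be the blow-up of $\mathbb P^3_k$ along the reduced closed subscheme $\{p_1,\dots,p_8\}$. Then $X_{\mathbf p}$ is a variety over $k$ and $$[X_{\mathbf p}]=\mathbb L^3+9\,\mathbb L^2+9\,\mathbb L+1\quad\text{in } K_0(\mathrm{Var}/k).$$ In particular the class does not depend on $\mathbf p$: for any two such $8$-tuples $\mathbf p,\mathbf q$ one has $[X_{\mathbf p}]=[X_{\mathbf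 q}]$, and $X_{\mathbf p}$ and $X_{\mathbf q}$ are L-equivalent. (This applies in particular to every pair of non-isomorphic, derived equivalent $X_{\mathbf p}$, $X_{\mathbf q}$, such as those in Lesieutre's infinite family, and so confirms the Kuznetsov–Shinder conjecture, that derived equivalent simply connected smooth projective varieties are L-equivalent, for these pairs.) -/

import Mathlib

open CategoryTheory CategoryTheory.Limits AlgebraicGeometry

universe u

noncomputable section

/-- A variety over `k`: a reduced separated scheme of finite type over `k` (it may be reducible
or empty). -/
structure IsVariety {k : Type u} [Field k] (X : Over (Spec (.of k))) : Prop where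
  isReduced : IsReduced X.left
  isSeparated : IsSeparated X.hom
  locallyOfFiniteType : LocallyOfFiniteType X.hom
  quasiCompact : QuasiCompact X.hom

/-- The type of all varieties over `k`. -/
structure Variety (k : Type u) [Field k] : Type (u + 1) where
  toOver : Over (Spec (.of k))
  isVariety : IsVariety toOver

/-- The defining relations of the Grothendieck ring of varieties, between elements of the free
commutative ring on all varieties over `k`. (A product of varieties over a field of characteristic
zero is reduced, so that the relation `prod` applies to every pair of varieties.) -/
inductive K0Rel (k : Type u) [Field k] :
    FreeCommRing (Variety k) → FreeCommRing (Variety k) → Prop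
  /-- Isomorphic varieties have the same class. -/
  | iso (X Y : Variety k) (e : X.toOver ≅ Y.toOver) : K0Rel k (.of X) (.of Y)
  /-- `[X] = [Z] + [U]` for `Z` a closed subvariety of `X` with open complement `U`. -/
  | scissor (X Z U : Variety k) (i : Z.toOver ⟶ X.toOver) (j : U.toOver ⟶ X.toOver)
      (hi : IsClosedImmersion i.left) (hj : IsOpenImmersion j.left)
      (h : IsCompl (Set.range i.left) (Set.range j.left)) :
      K0Rel k (.of X) (.of Z + .of U)
  /-- `[X ×ₖ Y] = [X] [Y]`. -/
  | prod (X Y P : Variety k) (fst : P.toOver ⟶ X.toOver) (snd : P.toOver ⟶ Y.toOver)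
      (h : IsPullback fst.left snd.left X.toOver.hom Y.toOver.hom) :
      K0Rel k (.of P) (.of X * .of Y)
  /-- `[Spec k] = 1`. -/
  | point (X : Variety k) (h : IsIso X.toOver.hom) : K0Rel k (.of X) 1

/-- The Grothendieck ring of varieties `K₀(Var/k)`. -/
abbrev K0Var (k : Type u) [Field k] : Type (u + 1) :=
  FreeCommRing (Variety k) ⧸ Ideal.ofRel (K0Rel k)

/-- The class `[X]` in `K₀(Var/k)`. -/
def K0Var.cls {k : Type u} [Field k] (X : Variety k) : K0Var k :=
  Ideal.Quotient.mk _ (FreeCommRing.of X)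

/-- The affine line `Spec k[t]` over `k`. -/
def affineLine (k : Type u) [Field k] : Variety k where
  toOver := Over.mk (Spec.map (CommRingCat.ofHom (algebraMap k (Polynomial k))))
  isVariety := by
    refine ⟨?_, ?_, ?_, ?_⟩
    · dsimp; infer_instance
    · dsimp; infer_instance
    · refine (HasRingHomProperty.Spec_iff (P := @LocallyOfFiniteType)).mpr ?_
      exact RingHom.finiteType_algebraMap.mpr inferInstance
    · dsimp; infer_instance

/-- The Lefschetz class `𝕃 = [𝔸¹]`. -/
def lefschetz (k : Type u) [Field k] : K0Var k := K0Var.cls (affineLine k)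

/-- `X` and `Y` are L-equivalent: `[X]` and `[Y]` agree in `K₀(Var/k)[𝕃⁻¹]`. -/
def LEquivalent {k : Type u} [Field k] (X Y : Variety k) : Prop :=
  algebraMap (K0Var k) (Localization.Away (lefschetz k)) (K0Var.cls X - K0Var.cls Y) = 0

attribute [local instance] MvPolynomial.gradedAlgebra in
/-- Projective 3-space over `k`: `Proj k[x₀, x₁, x₂, x₃]` with its structure morphism. -/
def projectiveThreeSpace (k : Type u) [Field k] : Over (Spec (.of k)) :=
  Over.mk (Y := Proj (MvPolynomial.homogeneousSubmodule (Fin 4) k))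
    (Proj.toSpecZero (MvPolynomial.homogeneousSubmodule (Fin 4) k) ≫
      Spec.map (CommRingCat.ofHom
        (algebraMap k (MvPolynomial.homogeneousSubmodule (Fin 4) k 0))))

/-- The `k`-rational points of a `k`-scheme: sections of its structure morphism. -/
abbrev RationalPoint {k : Type u} [Field k] (X : Over (Spec (.of k))) : Type u :=
  Over.mk (𝟙 (Spec (.of k))) ⟶ X

/-- The ideal sheaf of the closed subscheme formed by a family of rational points: the functions
that vanish at each of the points. -/
def idealOfPoints {k : Type u} [Field k] {X : Over (Spec (.of k))} {n : ℕ}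
    (p : Fin n → RationalPoint X) : X.left.IdealSheafData :=
  ⨅ i, (p i).left.ker

/-- An ideal sheaf is invertible (the closed subscheme is an effective Cartier divisor) if locally
it is generated by one element that is not a zero divisor. -/
def IsInvertibleIdeal {X : Scheme.{u}} (I : X.IdealSheafData) : Prop :=
  ∀ x : X, ∃ U : X.affineOpens, x ∈ U.1 ∧
    ∃ a ∈ nonZeroDivisors Γ(X, U.1), I.ideal U = Ideal.span {a}

/-- `π : X ⟶ Y` is the blow-up of `Y` along the closed subscheme with ideal sheaf `I`: the inverse
image ideal sheaf `π⁻¹I · 𝒪_X` is invertible, and `π` is universal (terminal) among the morphisms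
to `Y` with this property. -/
structure IsBlowUp {X Y : Scheme.{u}} (π : X ⟶ Y) (I : Y.IdealSheafData) : Prop where
  invertible : IsInvertibleIdeal (I.comap π)
  existsUnique_lift (T : Scheme.{u}) (f : T ⟶ Y) (hf : IsInvertibleIdeal (I.comap f)) :
    ∃! g : T ⟶ X, g ≫ π = f

end

/-!
A blow-up is covered by its restrictions over small open sets, so the blow-up at finitely many
rational points is studied over neighbourhoods of the points that contain no other of them, each an
open subset of affine space `𝔸ⁿ` with the point at the origin. The universal property identifies the
blow-up of `𝔸ⁿ` at the origin: it is covered by the loci where one coordinate `x i` generates the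
inverse image of the ideal `(x₁, …, xₙ)`, each of which is a copy of `𝔸ⁿ` with coordinates `x i` and
`x l / x i` for `l ≠ i`. Hence the blow-up is a variety. The part of the `i`-th chart that lies over
the origin and outside the earlier charts is cut out by the vanishing of `x i` and of `x l / x i`
for `l < i`, and so is an affine space. The exceptional divisor over a point is therefore stratified
by affine spaces of dimension `n - 1, …, 0` and has class `1 + 𝕃 + ⋯ + 𝕃ⁿ⁻¹`, while the point itself
has class `1`. Away from the points nothing changes, and the cells of `ℙⁿ` give its class
`1 + 𝕃 + ⋯ + 𝕃ⁿ`.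
-/

noncomputable section

/-! ### Invertible ideal sheaves on affine charts -/

/-- The order isomorphism between the ideals of `R` and the ideal sheaves on `Spec R`. -/
def specIdeal {R : CommRingCat.{u}} : Ideal R ≃o (Spec R).IdealSheafData :=
  (Scheme.ΓSpecIso R).commRingCatIsoToRingEquiv.idealComapOrderIso.trans
    Scheme.IdealSheafData.equivOfIsAffine.toOrderIso.symm

lemma ker_specMap {R S : CommRingCat.{u}} (φ : R ⟶ S) :
    (Spec.map φ).ker = specIdeal (RingHom.ker φ.hom) := by
  rw [Scheme.ker_of_isAffine]
  change _ = Scheme.IdealSheafData.ofIdealTop ((RingHom.ker φ.hom).comap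
    (Scheme.ΓSpecIso R).hom.hom)
  rw [RingHom.comap_ker, ← CommRingCat.hom_comp, ← Scheme.ΓSpecIso_naturality,
    CommRingCat.hom_comp, RingHom.ker_comp_of_injective _
      (ConcreteCategory.bijective_of_isIso (Scheme.ΓSpecIso S).hom).1]

lemma specIdeal_map {R S : CommRingCat.{u}} (φ : R ⟶ S) (K : Ideal S) :
    (specIdeal K).map (Spec.map φ) = specIdeal (K.comap φ.hom) := by
  have h : specIdeal K = (Spec.map (CommRingCat.ofHom (Ideal.Quotient.mk K))).ker := by
    rw [ker_specMap, CommRingCat.hom_ofHom, Ideal.mk_ker]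
  rw [h, Scheme.IdealSheafData.map_ker, ← Spec.map_comp, ker_specMap, CommRingCat.hom_comp,
    ← RingHom.comap_ker, CommRingCat.hom_ofHom, Ideal.mk_ker]

lemma specIdeal_comap {R S : CommRingCat.{u}} (φ : R ⟶ S) (J : Ideal R) :
    (specIdeal J).comap (Spec.map φ) = specIdeal (J.map φ.hom) := by
  refine eq_of_forall_ge_iff fun I ↦ ?_
  obtain ⟨K, rfl⟩ := specIdeal.surjective I
  rw [← Scheme.IdealSheafData.le_map_iff_comap_le, specIdeal_map, specIdeal.le_iff_le,
    specIdeal.le_iff_le, Ideal.map_le_iff_le_comap]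

/-- The image of an affine open immersion, as an affine open subset. -/
def affineRange {X : Scheme.{u}} {R : CommRingCat.{u}} (j : Spec R ⟶ X) [IsOpenImmersion j] :
    X.affineOpens :=
  ⟨j ''ᵁ ⊤, (isAffineOpen_top _).image_of_isOpenImmersion j⟩

/-- The functions on the image of an affine open immersion. -/
def affineRangeEquiv {X : Scheme.{u}} {R : CommRingCat.{u}} (j : Spec R ⟶ X)
    [IsOpenImmersion j] : R ≃+* Γ(X, (affineRange j).1) :=
  ((Scheme.ΓSpecIso R).symm ≪≫ (j.appIso ⊤).symm).commRingCatIsoToRingEquiv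

lemma comap_eq_specIdeal {X : Scheme.{u}} (I : X.IdealSheafData) {R : CommRingCat.{u}}
    (j : Spec R ⟶ X) [IsOpenImmersion j] :
    I.comap j = specIdeal ((I.ideal (affineRange j)).comap (affineRangeEquiv j)) := by
  apply specIdeal.symm.injective
  rw [OrderIso.symm_apply_apply]
  change ((I.comap j).ideal ⟨⊤, isAffineOpen_top _⟩).map
    (Scheme.ΓSpecIso R).commRingCatIsoToRingEquiv = _
  rw [Scheme.IdealSheafData.ideal_comap_of_isOpenImmersion, ← Ideal.comap_symm]
  exact Ideal.comap_comap _ _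

lemma comap_ringEquiv_eq_span_singleton_iff {R S : Type*} [CommRing R] [CommRing S] (e : R ≃+* S)
    (I : Ideal S) (a : R) : I.comap e = Ideal.span {a} ↔ I = Ideal.span {e a} := by
  have h : (Ideal.span {e a}).comap e = Ideal.span {a} := by
    rw [← Set.image_singleton, ← Ideal.map_span]
    exact Ideal.comap_map_of_bijective e e.bijective
  rw [← h]
  exact e.idealComapOrderIso.injective.eq_iff

lemma exists_comap_eq_specIdeal_span_iff {X : Scheme.{u}} (I : X.IdealSheafData)
    {R : CommRingCat.{u}} (j : Spec R ⟶ X) [IsOpenImmersion j] :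
    (∃ a ∈ nonZeroDivisors R, I.comap j = specIdeal (Ideal.span {a})) ↔
      ∃ a ∈ nonZeroDivisors Γ(X, (affineRange j).1),
        I.ideal (affineRange j) = Ideal.span {a} := by
  rw [comap_eq_specIdeal]
  refine (affineRangeEquiv j).toEquiv.exists_congr fun a ↦ and_congr ?_ ?_
  · rw [← MulEquivClass.map_nonZeroDivisors (affineRangeEquiv j)]
    exact (Submonoid.mem_map_iff_mem (affineRangeEquiv j).injective).symm
  · rw [specIdeal.injective.eq_iff]
    exact comap_ringEquiv_eq_span_singleton_iff _ _ a

lemma isInvertibleIdeal_iff {X : Scheme.{u}} (I : X.IdealSheafData) :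
    IsInvertibleIdeal I ↔ ∀ x : X, ∃ (R : CommRingCat.{u}) (j : Spec R ⟶ X)
      (_ : IsOpenImmersion j), x ∈ Set.range j ∧
      ∃ a ∈ nonZeroDivisors R, I.comap j = specIdeal (Ideal.span {a}) := by
  refine forall_congr' fun x ↦ ⟨fun ⟨⟨U, hU⟩, hxU, h⟩ ↦ ?_, fun ⟨R, j, hj, hx, h⟩ ↦ ?_⟩
  · replace hU : IsAffineOpen U := hU
    have hUj : ⟨U, hU⟩ = affineRange hU.fromSpec :=
      Subtype.ext (hU.fromSpec.image_top_eq_opensRange.trans hU.opensRange_fromSpec).symm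
    refine ⟨_, hU.fromSpec, inferInstance, by rwa [hU.range_fromSpec], ?_⟩
    exact (exists_comap_eq_specIdeal_span_iff I _).mpr (hUj ▸ h)
  · refine ⟨affineRange j, ?_, (exists_comap_eq_specIdeal_span_iff I j).mp h⟩
    exact (Set.ext_iff.mp (SetLike.ext'_iff.mp j.image_top_eq_opensRange) x).mpr hx

lemma isInvertibleIdeal_top {X : Scheme.{u}} : IsInvertibleIdeal (⊤ : X.IdealSheafData) := by
  intro x
  obtain ⟨U, hU, hx, -⟩ := TopologicalSpace.Opens.isBasis_iff_nbhd.mp X.isBasis_affineOpens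
    (TopologicalSpace.Opens.mem_top x)
  exact ⟨⟨U, hU⟩, hx, 1, one_mem _, by simp⟩

lemma map_mem_nonZeroDivisors_of_flat {R S : CommRingCat.{u}} (φ : R ⟶ S)
    [Flat (Spec.map φ)] {a : R} (ha : a ∈ nonZeroDivisors R) :
    φ.hom a ∈ nonZeroDivisors S := by
  have h : φ.hom.Flat := Flat.SpecMap_iff.mp inferInstance
  algebraize [φ.hom]
  refine mem_nonZeroDivisors_iff_right.mpr fun x hx ↦ ?_
  exact (Module.Flat.isSMulRegular_of_nonZeroDivisors (M := S) ha).right_eq_zero_of_smul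
    ((Algebra.smul_def a x).trans ((mul_comm _ _).trans hx))

lemma isUnit_of_mul_dvd {R : Type*} [CommRing R] {a b : R} (ha : a ∈ nonZeroDivisors R)
    (h : a * b ∣ a) : IsUnit b := by
  rw [← mul_one a, mul_assoc, dvd_cancel_left_mem_nonZeroDivisors ha, one_mul] at h
  exact isUnit_of_dvd_one h

lemma exists_specMap_comp_eq {T X : Scheme.{u}} (g : T ⟶ X) {R : CommRingCat.{u}}
    (j : Spec R ⟶ X) [IsOpenImmersion j] (O : T.Opens) (t : T) (htO : t ∈ O)
    (ht : g t ∈ Set.range j) :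
    ∃ (S : CommRingCat.{u}) (i : Spec S ⟶ T) (_ : IsOpenImmersion i) (φ : R ⟶ S),
      t ∈ Set.range i ∧ Set.range i ⊆ O ∧ i ≫ g = Spec.map φ ≫ j := by
  obtain ⟨U, hU, htU, hUO⟩ := TopologicalSpace.Opens.isBasis_iff_nbhd.mp T.isBasis_affineOpens
    (show t ∈ O ⊓ g ⁻¹ᵁ j.opensRange from ⟨htO, ht⟩)
  replace hU : IsAffineOpen U := hU
  have hr : Set.range (hU.fromSpec ≫ g) ⊆ Set.range j := by
    rintro _ ⟨y, rfl⟩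
    have hy : hU.fromSpec y ∈ U := hU.range_fromSpec.le ⟨y, rfl⟩
    rw [Scheme.Hom.comp_apply]
    exact (hUO hy).2
  refine ⟨_, hU.fromSpec, inferInstance, Spec.preimage (IsOpenImmersion.lift j _ hr),
    hU.range_fromSpec.ge htU, hU.range_fromSpec.le.trans fun _ hx ↦ (hUO hx).1, ?_⟩
  rw [Spec.map_preimage, IsOpenImmersion.lift_fac]

lemma exists_common_affine_refinement {T X : Scheme.{u}} (g : T ⟶ X) {R R' : CommRingCat.{u}}
    (j : Spec R ⟶ X) [IsOpenImmersion j] (j' : Spec R' ⟶ T) [IsOpenImmersion j'] (t : T)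
    (ht' : t ∈ Set.range j') (ht : g t ∈ Set.range j) :
    ∃ (S : CommRingCat.{u}) (φ : R ⟶ S) (ψ : R' ⟶ S), IsOpenImmersion (Spec.map ψ) ∧
      t ∈ Set.range (Spec.map ψ ≫ j') ∧ Spec.map ψ ≫ j' ≫ g = Spec.map φ ≫ j := by
  obtain ⟨S, i, hi, φ, hti, hr, e⟩ := exists_specMap_comp_eq g j j'.opensRange t ht' ht
  replace hr : Set.range i ⊆ Set.range j' := hr
  have hi' : Spec.map (Spec.preimage (IsOpenImmersion.lift j' i hr)) ≫ j' = i := by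
    rw [Spec.map_preimage, IsOpenImmersion.lift_fac]
  have : IsOpenImmersion (Spec.map (Spec.preimage (IsOpenImmersion.lift j' i hr)) ≫ j') := by
    rwa [hi']
  exact ⟨S, φ, _, .of_comp _ j', by rwa [hi'], by rw [reassoc_of% hi', e]⟩

lemma IsInvertibleIdeal.comap_of_isOpenImmersion {T X : Scheme.{u}} {I : X.IdealSheafData}
    (h : IsInvertibleIdeal I) (g : T ⟶ X) [IsOpenImmersion g] : IsInvertibleIdeal (I.comap g) := by
  rw [isInvertibleIdeal_iff] at h ⊢
  intro t
  obtain ⟨R, j, hj, ht, a, ha, e⟩ := h (g t)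
  obtain ⟨S, i, hi, φ, hti, -, hφ⟩ := exists_specMap_comp_eq g j ⊤ t trivial ht
  have : IsOpenImmersion (Spec.map φ ≫ j) := by rw [← hφ]; infer_instance
  have : IsOpenImmersion (Spec.map φ) := .of_comp _ j
  refine ⟨S, i, hi, hti, φ.hom a, map_mem_nonZeroDivisors_of_flat φ ha, ?_⟩
  rw [← Scheme.IdealSheafData.comap_comp, hφ, Scheme.IdealSheafData.comap_comp, e,
    specIdeal_comap, Ideal.map_span, Set.image_singleton]

section IsGeneratedAt

variable {σ : Type*} {A : CommRingCat.{u}} {x : σ → A} {T T' : Scheme.{u}}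

/-- Near `t`, the pull-back of `x i` along `f` is a nonzerodivisor that divides the pull-back of
every `x l`. The blow-up of `Spec A` in the ideal generated by the `x l` is covered by the loci
where this holds, for varying `i`. -/
def IsGeneratedAt (x : σ → A) (f : T ⟶ Spec A) (i : σ) (t : T) : Prop :=
  ∃ (R : CommRingCat.{u}) (j : Spec R ⟶ T) (_ : IsOpenImmersion j) (φ : A ⟶ R),
    t ∈ Set.range j ∧ j ≫ f = Spec.map φ ∧ φ.hom (x i) ∈ nonZeroDivisors R ∧
      ∀ l, φ.hom (x i) ∣ φ.hom (x l)

lemma exists_notMem_of_span_eq_span_singleton {R : Type*} [CommRing R] {y : σ → R} {a : R}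
    (h : Ideal.span (Set.range y) = Ideal.span {a}) (ha : a ∈ nonZeroDivisors R)
    (q : Ideal R) (hq : q ≠ ⊤) : ∃ (i : σ) (d : R), d ∉ q ∧ y i = a * d := by
  by_contra! hcon
  have hle : Ideal.span (Set.range y) ≤ Ideal.span {a} * q := by
    rw [Ideal.span_le]
    rintro _ ⟨i, rfl⟩
    obtain ⟨d, hd⟩ := Ideal.mem_span_singleton.mp (h.le (Ideal.subset_span ⟨i, rfl⟩))
    exact Ideal.mem_span_singleton_mul.mpr ⟨d, by_contra fun hn ↦ hcon i d hn hd, hd.symm⟩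
  obtain ⟨s, hs, e⟩ := Ideal.mem_span_singleton_mul.mp
    (hle (h.ge (Ideal.mem_span_singleton_self a)))
  exact hq (q.eq_top_of_isUnit_mem hs (isUnit_of_mul_dvd ha (dvd_of_eq e)))

namespace IsGeneratedAt

lemma of_notMem {f : T ⟶ Spec A} {R : CommRingCat.{u}} (j : Spec R ⟶ T) [IsOpenImmersion j]
    (φ : A ⟶ R) (e : j ≫ f = Spec.map φ) (q : Spec R) {i : σ} {a d : R} (hd : d ∉ q.asIdeal)
    (hi : φ.hom (x i) = a * d) (ha : a ∈ nonZeroDivisors R) (hl : ∀ l, a ∣ φ.hom (x l)) :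
    IsGeneratedAt x f i (j q) := by
  let ψ : R ⟶ .of (Localization.Away d) := CommRingCat.ofHom (algebraMap R _)
  have hψ : IsOpenImmersion (Spec.map ψ) := inferInstanceAs
    (IsOpenImmersion (Spec.map (CommRingCat.ofHom (algebraMap R (Localization.Away d)))))
  have hu : IsUnit (ψ.hom d) := IsLocalization.Away.algebraMap_isUnit d
  have hψi : (φ ≫ ψ).hom (x i) = ψ.hom a * ψ.hom d :=
    (congrArg ψ.hom hi).trans (map_mul _ _ _)
  obtain ⟨q', rfl⟩ : q ∈ Set.range (Spec.map ψ) :=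
    (PrimeSpectrum.localization_away_comap_range (Localization.Away d) d).ge hd
  refine ⟨_, Spec.map ψ ≫ j, inferInstance, φ ≫ ψ, ⟨q', rfl⟩, ?_, ?_, fun l ↦ ?_⟩
  · rw [Category.assoc, e, Spec.map_comp]
  · rw [hψi]
    exact mul_mem (map_mem_nonZeroDivisors_of_flat ψ ha) hu.mem_nonZeroDivisors
  · rw [hψi, hu.mul_right_dvd]
    exact map_dvd ψ.hom (hl l)

end IsGeneratedAt

lemma exists_isGeneratedAt {f : T ⟶ Spec A}
    (h : IsInvertibleIdeal ((specIdeal (Ideal.span (Set.range x))).comap f)) (t : T) :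
    ∃ i, IsGeneratedAt x f i t := by
  obtain ⟨R, j, hj, ⟨q, rfl⟩, a, ha, e⟩ := (isInvertibleIdeal_iff _).mp h t
  obtain ⟨φ, hφ⟩ := Spec.map_surjective (j ≫ f)
  rw [← Scheme.IdealSheafData.comap_comp, ← hφ, specIdeal_comap, specIdeal.injective.eq_iff,
    Ideal.map_span, ← Set.range_comp] at e
  obtain ⟨i, d, hd, hi⟩ := exists_notMem_of_span_eq_span_singleton e ha q.asIdeal q.2.ne_top
  exact ⟨i, .of_notMem j φ hφ.symm q hd hi ha fun l ↦
    Ideal.mem_span_singleton.mp (e.le (Ideal.subset_span ⟨l, rfl⟩))⟩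

lemma isInvertibleIdeal_of_isGeneratedAt {f : T ⟶ Spec A} (h : ∀ t, ∃ i, IsGeneratedAt x f i t) :
    IsInvertibleIdeal ((specIdeal (Ideal.span (Set.range x))).comap f) := by
  rw [isInvertibleIdeal_iff]
  intro t
  obtain ⟨i, R, j, hj, φ, ht, e, hi, hl⟩ := h t
  refine ⟨R, j, hj, ht, φ.hom (x i), hi, ?_⟩
  rw [← Scheme.IdealSheafData.comap_comp, e, specIdeal_comap, Ideal.map_span, ← Set.range_comp]
  refine congrArg specIdeal (le_antisymm (Ideal.span_le.mpr ?_) (Ideal.span_mono ?_))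
  · rintro _ ⟨l, rfl⟩
    exact Ideal.mem_span_singleton.mpr (hl l)
  · rintro _ rfl
    exact ⟨i, rfl⟩

namespace IsGeneratedAt

lemma comp {f : T ⟶ Spec A} (g : T' ⟶ T) {i : σ} {t : T'} (h : IsGeneratedAt x f i (g t))
    (hf : IsInvertibleIdeal ((specIdeal (Ideal.span (Set.range x))).comap (g ≫ f))) :
    IsGeneratedAt x (g ≫ f) i t := by
  obtain ⟨l, R', j', hj', φ', ht', e', hn', -⟩ := exists_isGeneratedAt hf t
  obtain ⟨R, j, hj, φ, ht, e, -, hl⟩ := h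
  obtain ⟨S, α, β, hβ, hts, hαβ⟩ := exists_common_affine_refinement g j j' t ht' ht
  have hS : (Spec.map β ≫ j') ≫ g ≫ f = Spec.map (φ ≫ α) := by
    rw [Category.assoc, reassoc_of% hαβ, e, Spec.map_comp]
  have hφ : φ ≫ α = φ' ≫ β := Spec.map_injective (by
    rw [← hS, Category.assoc, e', Spec.map_comp])
  refine ⟨S, Spec.map β ≫ j', inferInstance, φ ≫ α, hts, hS, ?_, fun m ↦ map_dvd α.hom (hl m)⟩
  obtain ⟨c, hc⟩ : (φ ≫ α).hom (x i) ∣ (φ' ≫ β).hom (x l) := by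
    rw [← hφ]
    exact map_dvd α.hom (hl l)
  have hnl : (φ' ≫ β).hom (x l) ∈ nonZeroDivisors S := map_mem_nonZeroDivisors_of_flat β hn'
  rw [hc] at hnl
  exact (mul_mem_nonZeroDivisors.mp hnl).1

lemma of_comp {f : T ⟶ Spec A} (g : T' ⟶ T) {i : σ} {t : T'} (h : IsGeneratedAt x (g ≫ f) i t)
    (hf : IsInvertibleIdeal ((specIdeal (Ideal.span (Set.range x))).comap f)) :
    IsGeneratedAt x f i (g t) := by
  obtain ⟨l, R, j, hj, φ, ⟨q, hq⟩, e, hn, hl⟩ := exists_isGeneratedAt hf (g t)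
  obtain ⟨R', j', hj', φ', ht', e', hn', hl'⟩ := h
  obtain ⟨S, α, β, hβ, ⟨r, hr⟩, hαβ⟩ := exists_common_affine_refinement g j j' t ht' ⟨q, hq⟩
  have hφ : φ ≫ α = φ' ≫ β := Spec.map_injective (by
    rw [Spec.map_comp, ← e, ← reassoc_of% hαβ, e', Spec.map_comp])
  obtain ⟨d, hd⟩ := hl i
  have hSi : (φ' ≫ β).hom (x i) = (φ' ≫ β).hom (x l) * α.hom d := by
    rw [← hφ]
    exact (congrArg α.hom hd).trans (map_mul _ _ _)
  have hni : (φ' ≫ β).hom (x i) ∈ nonZeroDivisors S := map_mem_nonZeroDivisors_of_flat β hn'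
  rw [hSi] at hni
  have hunit : IsUnit (α.hom d) :=
    isUnit_of_mul_dvd (mul_mem_nonZeroDivisors.mp hni).1 (hSi ▸ map_dvd β.hom (hl' l))
  have hrq : Spec.map α r = q := j.isOpenEmbedding.injective (by
    rw [hq, ← hr, ← Scheme.Hom.comp_apply, ← Scheme.Hom.comp_apply, ← hαβ, Category.assoc])
  rw [← hq]
  refine .of_notMem j φ e q (fun hdq ↦ ?_) hd hn hl
  rw [← hrq] at hdq
  exact r.2.ne_top (Ideal.eq_top_of_isUnit_mem _ hdq hunit)

end IsGeneratedAt

end IsGeneratedAt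

lemma isOpenImmersion_preimage_of_section {C X W : Scheme.{u}} (h : C ⟶ X) (j : W ⟶ X)
    [IsOpenImmersion j] (s : W ⟶ C) (hs : s ≫ h = j)
    (hr : ∀ (O : C.Opens) (a : O.toScheme ⟶ W), a ≫ j = O.ι ≫ h → a ≫ s = O.ι) :
    IsOpenImmersion ((h ⁻¹ᵁ j.opensRange).ι ≫ h) := by
  let O : C.Opens := h ⁻¹ᵁ j.opensRange
  have hO : Set.range (O.ι ≫ h) ⊆ Set.range j := by
    rintro _ ⟨y, rfl⟩
    rw [Scheme.Hom.comp_apply]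
    exact y.2
  have hsO : Set.range s ⊆ Set.range O.ι := by
    rintro _ ⟨w, rfl⟩
    rw [Scheme.Opens.range_ι]
    change h (s w) ∈ Set.range j
    rw [← Scheme.Hom.comp_apply, hs]
    exact ⟨w, rfl⟩
  let a : O.toScheme ⟶ W := IsOpenImmersion.lift j (O.ι ≫ h) hO
  let b : W ⟶ O.toScheme := IsOpenImmersion.lift O.ι s hsO
  have ha : a ≫ j = O.ι ≫ h := IsOpenImmersion.lift_fac _ _ _
  have hb : b ≫ O.ι = s := IsOpenImmersion.lift_fac _ _ _
  have hab : a ≫ b = 𝟙 _ := by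
    rw [← cancel_mono O.ι, Category.assoc, hb, hr O a ha, Category.id_comp]
  have hba : b ≫ a = 𝟙 _ := by
    rw [← cancel_mono j, Category.assoc, ha, reassoc_of% hb, hs, Category.id_comp]
  have : IsIso a := ⟨b, hab, hba⟩
  change IsOpenImmersion (O.ι ≫ h)
  rw [← ha]
  infer_instance

lemma isOpenImmersion_of_exists_section {C X : Scheme.{u}} (h : C ⟶ X)
    (H : ∀ c : C, ∃ (W : Scheme.{u}) (j : W ⟶ X) (_ : IsOpenImmersion j) (s : W ⟶ C),
      h c ∈ Set.range j ∧ s ≫ h = j ∧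
      ∀ (O : C.Opens) (a : O.toScheme ⟶ W), a ≫ j = O.ι ≫ h → a ≫ s = O.ι) :
    IsOpenImmersion h := by
  have hopen (c : C) : ∃ O : C.Opens, (∀ c', h c' = h c → c' ∈ O) ∧ IsOpenImmersion (O.ι ≫ h) := by
    obtain ⟨W, j, hj, s, hc, hs, hr⟩ := H c
    exact ⟨h ⁻¹ᵁ j.opensRange, fun c' hc' ↦ by simpa [hc'] using hc,
      isOpenImmersion_preimage_of_section h j s hs hr⟩
  refine IsOpenImmersion.of_forall_source_exists h (fun c c' e ↦ ?_) fun c ↦ ?_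
  · obtain ⟨O, hO, hi⟩ := hopen c
    have hinj : Function.Injective (O.ι ≫ h) := (O.ι ≫ h).isOpenEmbedding.injective
    obtain ⟨y, rfl⟩ : c ∈ Set.range O.ι := by rw [Scheme.Opens.range_ι]; exact hO c rfl
    obtain ⟨y', rfl⟩ : c' ∈ Set.range O.ι := by rw [Scheme.Opens.range_ι]; exact hO c' e.symm
    rw [← Scheme.Hom.comp_apply, ← Scheme.Hom.comp_apply] at e
    rw [hinj e]
  · obtain ⟨O, hO, hi⟩ := hopen c
    exact ⟨O, O.ι, inferInstance, by simpa using hO c rfl, hi⟩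

/-- The ring of functions on the affine space over `k` with coordinates indexed by `σ`. -/
abbrev polyRing (k : Type u) [CommRing k] (σ : Type) : CommRingCat.{u} := .of (MvPolynomial σ k)

/-- The ideal sheaf of the origin of affine space. -/
def originIdeal (k : Type u) [CommRing k] (σ : Type) : (Spec (polyRing k σ)).IdealSheafData :=
  specIdeal (R := polyRing k σ) (MvPolynomial.idealOfVars σ k)

lemma polyRing_hom_ext {k : Type u} [CommRing k] {σ : Type} {R : CommRingCat.{u}}
    {φ ψ : polyRing k σ ⟶ R}
    (hC : ∀ a : k, φ.hom (MvPolynomial.C a) = ψ.hom (MvPolynomial.C a))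
    (hX : ∀ l, φ.hom (MvPolynomial.X l) = ψ.hom (MvPolynomial.X l)) : φ = ψ :=
  CommRingCat.hom_ext (MvPolynomial.ringHom_ext hC hX)

section chartHom

variable {k : Type u} [CommRing k] {σ : Type} [DecidableEq σ] {R : CommRingCat.{u}}

/-- The `i`-th chart of the blow-up of affine space at the origin: the substitution
`X l ↦ X i * X l` for `l ≠ i`, with `X i` fixed. -/
def chartHom (k : Type u) [CommRing k] {σ : Type} [DecidableEq σ] (i : σ) :
    polyRing k σ ⟶ polyRing k σ :=
  CommRingCat.ofHom (MvPolynomial.aeval (R := k)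
    (fun l ↦ if l = i then MvPolynomial.X i else
      MvPolynomial.X i * MvPolynomial.X l : σ → MvPolynomial σ k)).toRingHom

lemma chartHom_C (i : σ) (a : k) :
    (chartHom k i).hom (MvPolynomial.C a) = MvPolynomial.C a :=
  MvPolynomial.aeval_C _ a

lemma chartHom_X_self (i : σ) :
    (chartHom k i).hom (MvPolynomial.X i) = MvPolynomial.X i :=
  (MvPolynomial.aeval_X _ i).trans (if_pos rfl)

lemma chartHom_X_of_ne {i l : σ} (h : l ≠ i) :
    (chartHom k i).hom (MvPolynomial.X l) = MvPolynomial.X i * MvPolynomial.X l :=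
  (MvPolynomial.aeval_X _ l).trans (if_neg h)

lemma chartHom_comp_C (i : σ) (ψ : polyRing k σ ⟶ R) (a : k) :
    (chartHom k i ≫ ψ).hom (MvPolynomial.C a) = ψ.hom (MvPolynomial.C a) :=
  congrArg ψ.hom (chartHom_C i a)

lemma chartHom_comp_X_self (i : σ) (ψ : polyRing k σ ⟶ R) :
    (chartHom k i ≫ ψ).hom (MvPolynomial.X i) = ψ.hom (MvPolynomial.X i) :=
  congrArg ψ.hom (chartHom_X_self i)

lemma chartHom_comp_X_of_ne {i l : σ} (h : l ≠ i) (ψ : polyRing k σ ⟶ R) :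
    (chartHom k i ≫ ψ).hom (MvPolynomial.X l) =
      ψ.hom (MvPolynomial.X i) * ψ.hom (MvPolynomial.X l) :=
  (congrArg ψ.hom (chartHom_X_of_ne h)).trans (map_mul _ _ _)

lemma exists_chartHom_comp_eq (φ : polyRing k σ ⟶ R) (i : σ)
    (h : ∀ l, φ.hom (MvPolynomial.X i) ∣ φ.hom (MvPolynomial.X l)) :
    ∃ ψ : polyRing k σ ⟶ R, chartHom k i ≫ ψ = φ := by
  choose c hc using h
  let ψ : polyRing k σ ⟶ R := CommRingCat.ofHom (MvPolynomial.eval₂Hom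
    (φ.hom.comp MvPolynomial.C) (fun l ↦ if l = i then φ.hom (MvPolynomial.X i) else c l))
  have hψX (l : σ) : ψ.hom (MvPolynomial.X l) =
      if l = i then φ.hom (MvPolynomial.X i) else c l := MvPolynomial.eval₂Hom_X' _ _ l
  refine ⟨ψ, polyRing_hom_ext (fun a ↦ ?_) (fun l ↦ ?_)⟩
  · exact (chartHom_comp_C i ψ a).trans (MvPolynomial.eval₂Hom_C _ _ a)
  · obtain rfl | hl := eq_or_ne l i
    · rw [chartHom_comp_X_self, hψX, if_pos rfl]
    · rw [chartHom_comp_X_of_ne hl, hψX, hψX, if_pos rfl, if_neg hl, ← hc l]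

lemma eq_of_chartHom_comp_eq {ψ ψ' : polyRing k σ ⟶ R} (i : σ)
    (h : chartHom k i ≫ ψ = chartHom k i ≫ ψ')
    (hn : (chartHom k i ≫ ψ).hom (MvPolynomial.X i) ∈ nonZeroDivisors R) : ψ = ψ' := by
  rw [chartHom_comp_X_self] at hn
  have hi := congr($(h).hom (MvPolynomial.X i))
  rw [chartHom_comp_X_self, chartHom_comp_X_self] at hi
  refine polyRing_hom_ext (fun a ↦ ?_) (fun l ↦ ?_)
  · exact (chartHom_comp_C i ψ a).symm.trans
      (congr($(h).hom (MvPolynomial.C a)).trans (chartHom_comp_C i ψ' a))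
  · obtain rfl | hl := eq_or_ne l i
    · exact hi
    · have hl' := congr($(h).hom (MvPolynomial.X l))
      rw [chartHom_comp_X_of_ne hl, chartHom_comp_X_of_ne hl, ← hi] at hl'
      exact (mul_cancel_left_mem_nonZeroDivisors hn).mp hl'

lemma mul_eq_one_of_chartHom_comp_eq {i l : σ} (hil : i ≠ l) {ψ ψ' : polyRing k σ ⟶ R}
    (h : chartHom k i ≫ ψ = chartHom k l ≫ ψ')
    (hn : (chartHom k i ≫ ψ).hom (MvPolynomial.X i) ∈ nonZeroDivisors R) :
    ψ.hom (MvPolynomial.X l) * ψ'.hom (MvPolynomial.X i) = 1 := by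
  have hi := congr($(h).hom (MvPolynomial.X i))
  have hl := congr($(h).hom (MvPolynomial.X l))
  rw [chartHom_comp_X_self] at hn
  rw [chartHom_comp_X_self, chartHom_comp_X_of_ne hil] at hi
  rw [chartHom_comp_X_self, chartHom_comp_X_of_ne hil.symm] at hl
  rw [← mul_cancel_left_mem_nonZeroDivisors hn, mul_one, ← mul_assoc, hl, ← hi]

lemma isGeneratedAt_chartHom (i : σ) (y : Spec (polyRing k σ)) :
    IsGeneratedAt (A := polyRing k σ) MvPolynomial.X (Spec.map (chartHom k i)) i y := by
  refine ⟨polyRing k σ, 𝟙 _, inferInstance, chartHom k i, ⟨y, rfl⟩, Category.id_comp _, ?_,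
    fun l ↦ ?_⟩
  · rw [chartHom_X_self]
    exact MvPolynomial.isRegular_X.mem_nonZeroDivisors
  · rw [chartHom_X_self]
    obtain rfl | hl := eq_or_ne l i
    · rw [chartHom_X_self]
    · rw [chartHom_X_of_ne hl]
      exact Dvd.intro _ rfl

lemma isInvertibleIdeal_comap_chartHom (i : σ) :
    IsInvertibleIdeal ((originIdeal k σ).comap (Spec.map (chartHom k i))) :=
  isInvertibleIdeal_of_isGeneratedAt fun y ↦ ⟨i, isGeneratedAt_chartHom i y⟩

lemma eq_of_comp_specMap_chartHom_eq {T : Scheme.{u}} {e e' : T ⟶ Spec (polyRing k σ)} (i : σ)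
    (h : e ≫ Spec.map (chartHom k i) = e' ≫ Spec.map (chartHom k i))
    (hi : IsInvertibleIdeal ((originIdeal k σ).comap (e ≫ Spec.map (chartHom k i)))) :
    e = e' := by
  refine Scheme.hom_ext_of_forall _ _ fun t ↦ ?_
  obtain ⟨R, j, hj, φ, ht, hφ, hn, -⟩ :=
    (isGeneratedAt_chartHom (k := k) i (e t)).comp e hi
  refine ⟨j.opensRange, ht, ?_⟩
  obtain ⟨ψ, hψ⟩ := Spec.map_surjective (j ≫ e)
  obtain ⟨ψ', hψ'⟩ := Spec.map_surjective (j ≫ e')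
  have hφψ : chartHom k i ≫ ψ = φ := Spec.map_injective (by
    rw [Spec.map_comp, hψ, Category.assoc, hφ])
  have hφψ' : chartHom k i ≫ ψ' = φ := Spec.map_injective (by
    rw [Spec.map_comp, hψ', Category.assoc, ← h, hφ])
  have hψψ' : ψ = ψ' := eq_of_chartHom_comp_eq i (hφψ.trans hφψ'.symm) (hφψ ▸ hn)
  rw [← cancel_epi j.isoOpensRange.hom, Scheme.Hom.isoOpensRange_hom_ι_assoc,
    Scheme.Hom.isoOpensRange_hom_ι_assoc, ← hψ, ← hψ', hψψ']

end chartHom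

/-! ### The blow-up of affine space at the origin -/

lemma IsGeneratedAt.comp_iff {σ : Type*} {A : CommRingCat.{u}} {x : σ → A} {T T' : Scheme.{u}}
    {f : T ⟶ Spec A} (g : T' ⟶ T) {i : σ} {t : T'}
    (hf : IsInvertibleIdeal ((specIdeal (Ideal.span (Set.range x))).comap f))
    (hgf : IsInvertibleIdeal ((specIdeal (Ideal.span (Set.range x))).comap (g ≫ f))) :
    IsGeneratedAt x (g ≫ f) i t ↔ IsGeneratedAt x f i (g t) :=
  ⟨fun h ↦ h.of_comp g hf, fun h ↦ h.comp g hgf⟩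

lemma range_subset_range_of_closedPoint_mem {R : CommRingCat.{u}} [IsLocalRing R]
    {X U : Scheme.{u}} (g : Spec R ⟶ X) (j : U ⟶ X) [IsOpenImmersion j]
    (h : g (IsLocalRing.closedPoint R) ∈ Set.range j) : Set.range g ⊆ Set.range j := by
  have htop : g ⁻¹ᵁ j.opensRange = ⊤ := (IsLocalRing.closed_point_mem_iff (R := R)).mp h
  rintro _ ⟨r, rfl⟩
  exact htop.ge (TopologicalSpace.Opens.mem_top r)

instance isZariskiLocalAtSource_locallyOfFiniteType :
    IsZariskiLocalAtSource (@LocallyOfFiniteType : MorphismProperty Scheme.{u}) :=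
  HasRingHomProperty.instIsZariskiLocalAtSource (Q := RingHom.FiniteType)

instance isZariskiLocalAtTarget_locallyOfFiniteType :
    IsZariskiLocalAtTarget (@LocallyOfFiniteType : MorphismProperty Scheme.{u}) :=
  HasRingHomProperty.instIsZariskiLocalAtTarget _

section IsLocalBlowUp

variable {k : Type u} [CommRing k] {σ : Type}

/-- `f : X ⟶ 𝔸ⁿ` is the blow-up of the open subset `V` of `𝔸ⁿ` at the origin. -/
structure IsLocalBlowUp (V : (Spec (polyRing k σ)).Opens) {X : Scheme.{u}}
    (f : X ⟶ Spec (polyRing k σ)) : Prop where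
  mem (x : X) : f x ∈ V
  invertible : IsInvertibleIdeal ((originIdeal k σ).comap f)
  existsUnique_lift (T : Scheme.{u}) (g : T ⟶ Spec (polyRing k σ)) (hg : ∀ t, g t ∈ V)
    (hi : IsInvertibleIdeal ((originIdeal k σ).comap g)) : ∃! h : T ⟶ X, h ≫ f = g

lemma IsLocalBlowUp.hom_ext {V : (Spec (polyRing k σ)).Opens} {X : Scheme.{u}}
    {f : X ⟶ Spec (polyRing k σ)} (H : IsLocalBlowUp V f) {T : Scheme.{u}} {g g' : T ⟶ X}
    (h : g ≫ f = g' ≫ f) (hi : IsInvertibleIdeal ((originIdeal k σ).comap (g ≫ f))) :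
    g = g' := by
  refine (H.existsUnique_lift T (g ≫ f) (fun t ↦ ?_) hi).unique rfl h.symm
  rw [Scheme.Hom.comp_apply]
  exact H.mem _

variable [DecidableEq σ]

lemma isGeneratedAt_chartHom_iff {i l : σ} (h : l ≠ i) (y : Spec (polyRing k σ)) :
    IsGeneratedAt (A := polyRing k σ) MvPolynomial.X (Spec.map (chartHom k i)) l y ↔
      (MvPolynomial.X l : MvPolynomial σ k) ∉ y.asIdeal := by
  refine ⟨fun ⟨R, j, hj, φ, ⟨r, hr⟩, e, hn, hl⟩ hmem ↦ ?_, fun hl ↦ ?_⟩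
  · obtain ⟨ρ, rfl⟩ := Spec.map_surjective j
    rw [← Spec.map_comp] at e
    obtain rfl := Spec.map_injective e
    replace hl := hl i
    rw [chartHom_comp_X_of_ne h] at hn
    rw [chartHom_comp_X_of_ne h, chartHom_comp_X_self] at hl
    have hu : IsUnit (ρ.hom (MvPolynomial.X l)) :=
      isUnit_of_mul_dvd (mul_mem_nonZeroDivisors.mp hn).1 hl
    rw [← hr] at hmem
    exact r.2.ne_top (Ideal.eq_top_of_isUnit_mem _ hmem hu)
  · refine .of_notMem (𝟙 _) (chartHom k i) (Category.id_comp _) y hl (chartHom_X_of_ne h)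
      MvPolynomial.isRegular_X.mem_nonZeroDivisors fun m ↦ ?_
    obtain rfl | hm := eq_or_ne m i
    · rw [chartHom_X_self]
    · rw [chartHom_X_of_ne hm]
      exact Dvd.intro _ rfl

/-- The domain of the `i`-th chart of the blow-up of `V` at the origin. -/
def chartOpens (V : (Spec (polyRing k σ)).Opens) (i : σ) : (Spec (polyRing k σ)).Opens :=
  Spec.map (chartHom k i) ⁻¹ᵁ V

lemma isInvertibleIdeal_comap_chartOpens (V : (Spec (polyRing k σ)).Opens) (i : σ) :
    IsInvertibleIdeal ((originIdeal k σ).comap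
      ((chartOpens V i).ι ≫ Spec.map (chartHom k i))) := by
  rw [Scheme.IdealSheafData.comap_comp]
  exact (isInvertibleIdeal_comap_chartHom i).comap_of_isOpenImmersion _

namespace IsLocalBlowUp

variable {V : (Spec (polyRing k σ)).Opens} {X : Scheme.{u}} {f : X ⟶ Spec (polyRing k σ)}

lemma exists_chart (H : IsLocalBlowUp V f) (i : σ) :
    ∃ h : (chartOpens V i).toScheme ⟶ X,
      h ≫ f = (chartOpens V i).ι ≫ Spec.map (chartHom k i) := by
  refine (H.existsUnique_lift _ _ (fun t ↦ ?_) (isInvertibleIdeal_comap_chartOpens V i)).exists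
  rw [Scheme.Hom.comp_apply]
  exact t.2

/-- The `i`-th chart of a blow-up. -/
def chart (H : IsLocalBlowUp V f) (i : σ) : (chartOpens V i).toScheme ⟶ X :=
  (H.exists_chart i).choose

lemma chart_comp (H : IsLocalBlowUp V f) (i : σ) :
    H.chart i ≫ f = (chartOpens V i).ι ≫ Spec.map (chartHom k i) :=
  (H.exists_chart i).choose_spec

lemma isInvertibleIdeal_comap_chart_comp (H : IsLocalBlowUp V f) (i : σ) :
    IsInvertibleIdeal ((originIdeal k σ).comap (H.chart i ≫ f)) := by
  rw [H.chart_comp]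
  exact isInvertibleIdeal_comap_chartOpens V i

lemma isGeneratedAt_chart_apply_iff (H : IsLocalBlowUp V f) (i l : σ)
    (y : (chartOpens V i).toScheme) :
    IsGeneratedAt (A := polyRing k σ) MvPolynomial.X f l (H.chart i y) ↔
      IsGeneratedAt (A := polyRing k σ) MvPolynomial.X (Spec.map (chartHom k i)) l
        ((chartOpens V i).ι y) := by
  rw [← IsGeneratedAt.comp_iff _ H.invertible (H.isInvertibleIdeal_comap_chart_comp i),
    H.chart_comp]
  exact IsGeneratedAt.comp_iff _ (isInvertibleIdeal_comap_chartHom i)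
    (isInvertibleIdeal_comap_chartOpens V i)

lemma isGeneratedAt_chart (H : IsLocalBlowUp V f) (i : σ) (y : (chartOpens V i).toScheme) :
    IsGeneratedAt (A := polyRing k σ) MvPolynomial.X f i (H.chart i y) :=
  (H.isGeneratedAt_chart_apply_iff i i y).mpr (isGeneratedAt_chartHom i _)

lemma exists_comp_chart_eq (H : IsLocalBlowUp V f) {R : CommRingCat.{u}} (j : Spec R ⟶ X)
    [IsOpenImmersion j] (i : σ) (ψ : polyRing k σ ⟶ R)
    (e : j ≫ f = Spec.map (chartHom k i ≫ ψ)) :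
    ∃ s : Spec R ⟶ (chartOpens V i).toScheme,
      s ≫ (chartOpens V i).ι = Spec.map ψ ∧ s ≫ H.chart i = j := by
  have hr : Set.range (Spec.map ψ) ⊆ Set.range (chartOpens V i).ι := by
    rintro _ ⟨r, rfl⟩
    rw [Scheme.Opens.range_ι]
    change Spec.map (chartHom k i) (Spec.map ψ r) ∈ V
    rw [← Scheme.Hom.comp_apply, ← Spec.map_comp, ← e, Scheme.Hom.comp_apply]
    exact H.mem _
  refine ⟨IsOpenImmersion.lift (chartOpens V i).ι (Spec.map ψ) hr,
    IsOpenImmersion.lift_fac _ _ _, (H.hom_ext ?_ ?_).symm⟩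
  · rw [Category.assoc, H.chart_comp, IsOpenImmersion.lift_fac_assoc, e, Spec.map_comp]
  · rw [Scheme.IdealSheafData.comap_comp]
    exact H.invertible.comap_of_isOpenImmersion j

instance isOpenImmersion_chart (H : IsLocalBlowUp V f) (i : σ) :
    IsOpenImmersion (H.chart i) := by
  refine isOpenImmersion_of_exists_section _ fun c ↦ ?_
  obtain ⟨R, j, hj, φ, hc, e, -, hl⟩ := H.isGeneratedAt_chart i c
  obtain ⟨ψ, hψ⟩ := exists_chartHom_comp_eq φ i hl
  obtain ⟨s, -, hs⟩ := H.exists_comp_chart_eq j i ψ (hψ ▸ e)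
  refine ⟨_, j, hj, s, hc, hs, fun O a ha ↦ ?_⟩
  have has : (a ≫ s ≫ (chartOpens V i).ι) ≫ Spec.map (chartHom k i) =
      (O.ι ≫ (chartOpens V i).ι) ≫ Spec.map (chartHom k i) := by
    rw [Category.assoc, Category.assoc, Category.assoc, ← H.chart_comp, reassoc_of% hs,
      reassoc_of% ha]
  rw [← cancel_mono (chartOpens V i).ι, Category.assoc]
  refine eq_of_comp_specMap_chartHom_eq i has ?_
  rw [has, Category.assoc, Scheme.IdealSheafData.comap_comp]
  exact (isInvertibleIdeal_comap_chartOpens V i).comap_of_isOpenImmersion _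

lemma mem_range_chart_iff (H : IsLocalBlowUp V f) (i : σ) (x : X) :
    x ∈ Set.range (H.chart i) ↔ IsGeneratedAt (A := polyRing k σ) MvPolynomial.X f i x := by
  constructor
  · rintro ⟨y, rfl⟩
    exact H.isGeneratedAt_chart i y
  · rintro ⟨R, j, hj, φ, ⟨r, rfl⟩, e, -, hl⟩
    obtain ⟨ψ, hψ⟩ := exists_chartHom_comp_eq φ i hl
    obtain ⟨s, -, hs⟩ := H.exists_comp_chart_eq j i ψ (hψ ▸ e)
    exact ⟨s r, by rw [← Scheme.Hom.comp_apply, hs]⟩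

lemma exists_mem_range_chart (H : IsLocalBlowUp V f) (x : X) :
    ∃ i, x ∈ Set.range (H.chart i) := by
  obtain ⟨i, hi⟩ := exists_isGeneratedAt H.invertible x
  exact ⟨i, (H.mem_range_chart_iff i x).mpr hi⟩

lemma chart_mem_range_chart_iff (H : IsLocalBlowUp V f) {i l : σ} (h : l ≠ i)
    (y : (chartOpens V i).toScheme) : H.chart i y ∈ Set.range (H.chart l) ↔
      (MvPolynomial.X l : MvPolynomial σ k) ∉
        PrimeSpectrum.asIdeal ((chartOpens V i).ι y) := by
  rw [H.mem_range_chart_iff, H.isGeneratedAt_chart_apply_iff, isGeneratedAt_chartHom_iff h]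

/-- The cover of a blow-up by its charts. -/
def cover (H : IsLocalBlowUp V f) : Scheme.OpenCover.{0} X :=
  .mkOfCovers σ (fun i ↦ (chartOpens V i).toScheme) H.chart H.exists_mem_range_chart
    H.isOpenImmersion_chart

omit [DecidableEq σ] in
lemma isReduced [IsReduced (Spec (polyRing k σ))] (H : IsLocalBlowUp V f) : IsReduced X := by
  classical
  have (i : H.cover.I₀) : IsReduced (H.cover.X i) := by
    change IsReduced (chartOpens V i).toScheme
    exact isReduced_of_isOpenImmersion (chartOpens V i).ι
  exact IsReduced.of_openCover _ H.cover

omit [DecidableEq σ] in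
lemma locallyOfFiniteType [Finite σ] (H : IsLocalBlowUp V f) : LocallyOfFiniteType f := by
  classical
  suffices h : ∀ i, LocallyOfFiniteType (H.chart i ≫ f) from
    IsZariskiLocalAtSource.of_openCover H.cover h
  intro i
  rw [H.chart_comp]
  have : LocallyOfFiniteType (Spec.map (chartHom k i)) := by
    rw [HasRingHomProperty.Spec_iff (P := @LocallyOfFiniteType)]
    refine RingHom.FiniteType.of_comp_finiteType (f := (MvPolynomial.C : k →+* _)) ?_
    have hC : (chartHom k i).hom.comp (MvPolynomial.C : k →+* _) = MvPolynomial.C :=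
      RingHom.ext (chartHom_C i)
    rw [hC]
    exact RingHom.finiteType_algebraMap.mpr inferInstance
  infer_instance

omit [DecidableEq σ] in
lemma compactSpace [Finite σ] [IsNoetherianRing k] (H : IsLocalBlowUp V f) :
    CompactSpace X := by
  classical
  have : Finite H.cover.I₀ := ‹Finite σ›
  have (i : H.cover.I₀) : CompactSpace (H.cover.X i) := by
    change CompactSpace (chartOpens V i).toScheme
    exact isCompact_iff_compactSpace.mp (TopologicalSpace.NoetherianSpace.isCompact _)
  exact H.cover.compactSpace

lemma exists_overlap (H : IsLocalBlowUp V f) {i l : σ} (hil : i ≠ l) {x : X}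
    (hi : x ∈ Set.range (H.chart i)) (hl : x ∈ Set.range (H.chart l)) :
    ∃ (S : CommRingCat.{u}) (j : Spec S ⟶ X) (_ : IsOpenImmersion j) (ψ ψ' : polyRing k σ ⟶ S),
      x ∈ Set.range j ∧ j ≫ f = Spec.map (chartHom k i ≫ ψ) ∧
      j ≫ f = Spec.map (chartHom k l ≫ ψ') ∧
      ψ.hom (MvPolynomial.X l) * ψ'.hom (MvPolynomial.X i) = 1 := by
  obtain ⟨R, j, hj, φ, hx, e, hn, hd⟩ := (H.mem_range_chart_iff i x).mp hi
  obtain ⟨R', j', hj', φ', hx', e', -, hd'⟩ := (H.mem_range_chart_iff l x).mp hl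
  obtain ⟨S, α, β, hβ, hxS, hαβ⟩ := exists_common_affine_refinement (𝟙 X) j' j x hx hx'
  rw [Category.comp_id] at hαβ
  have hφ : φ ≫ β = φ' ≫ α := by
    apply Spec.map_injective
    rw [Spec.map_comp, Spec.map_comp, ← e, ← e', reassoc_of% hαβ]
  obtain ⟨ψ, hψ⟩ := exists_chartHom_comp_eq (φ ≫ β) i fun m ↦ map_dvd β.hom (hd m)
  obtain ⟨ψ', hψ'⟩ := exists_chartHom_comp_eq (φ' ≫ α) l fun m ↦ map_dvd α.hom (hd' m)
  have hS : (Spec.map β ≫ j) ≫ f = Spec.map (φ ≫ β) := by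
    rw [Category.assoc, e, Spec.map_comp]
  refine ⟨S, Spec.map β ≫ j, inferInstance, ψ, ψ', hxS, by rw [hψ, hS], by rw [hψ', ← hφ, hS],
    mul_eq_one_of_chartHom_comp_eq hil (by rw [hψ, hψ', hφ]) ?_⟩
  rw [hψ]
  exact map_mem_nonZeroDivisors_of_flat β hn

lemma eq_comp_of_comp_chart_eq (H : IsLocalBlowUp V f) {S K : CommRingCat.{u}} {j : Spec S ⟶ X}
    [IsOpenImmersion j] {i : σ} {ψ : polyRing k σ ⟶ S} (e : j ≫ f = Spec.map (chartHom k i ≫ ψ))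
    {κ : S ⟶ K} {s : Spec K ⟶ (chartOpens V i).toScheme} (hs : s ≫ H.chart i = Spec.map κ ≫ j)
    {χ : polyRing k σ ⟶ K} (hχ : s ≫ (chartOpens V i).ι = Spec.map χ) : χ = ψ ≫ κ := by
  obtain ⟨t, ht, ht'⟩ := H.exists_comp_chart_eq j i ψ e
  have hst : s = Spec.map κ ≫ t := by rw [← cancel_mono (H.chart i), Category.assoc, ht', hs]
  apply Spec.map_injective
  rw [← hχ, hst, Category.assoc, ht, Spec.map_comp]

lemma mul_eq_one_of_comp_chart_eq (H : IsLocalBlowUp V f) {K : CommRingCat.{u}} [IsLocalRing K]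
    {i l : σ} (hil : i ≠ l) {s : Spec K ⟶ (chartOpens V i).toScheme}
    {s' : Spec K ⟶ (chartOpens V l).toScheme} (e : s ≫ H.chart i = s' ≫ H.chart l)
    {χ χ' : polyRing k σ ⟶ K} (hχ : s ≫ (chartOpens V i).ι = Spec.map χ)
    (hχ' : s' ≫ (chartOpens V l).ι = Spec.map χ') :
    χ.hom (MvPolynomial.X l) * χ'.hom (MvPolynomial.X i) = 1 := by
  obtain ⟨S, j, hj, ψ, ψ', hx, hψ, hψ', hmul⟩ := H.exists_overlap hil
    (x := (s ≫ H.chart i) (IsLocalRing.closedPoint K)) ⟨_, rfl⟩ (e ▸ ⟨_, rfl⟩)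
  have hr := range_subset_range_of_closedPoint_mem _ j hx
  obtain ⟨κ, hκ⟩ := Spec.map_surjective (IsOpenImmersion.lift j _ hr)
  have hκj : s ≫ H.chart i = Spec.map κ ≫ j := by rw [hκ, IsOpenImmersion.lift_fac]
  rw [H.eq_comp_of_comp_chart_eq hψ hκj hχ, H.eq_comp_of_comp_chart_eq hψ' (e ▸ hκj) hχ']
  exact (map_mul κ.hom _ _).symm.trans ((congrArg κ.hom hmul).trans (map_one κ.hom))

lemma exists_comp_chart_eq_of_closedPoint_mem (H : IsLocalBlowUp V f) {R : CommRingCat.{u}}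
    [IsLocalRing R] {g : Spec R ⟶ X} {i : σ}
    (h : g (IsLocalRing.closedPoint R) ∈ Set.range (H.chart i)) :
    ∃ (s : Spec R ⟶ (chartOpens V i).toScheme) (ψ : polyRing k σ ⟶ R),
      s ≫ (chartOpens V i).ι = Spec.map ψ ∧ s ≫ H.chart i = g :=
  ⟨IsOpenImmersion.lift _ g (range_subset_range_of_closedPoint_mem g _ h), Spec.preimage _,
    (Spec.map_preimage _).symm, IsOpenImmersion.lift_fac _ _ _⟩

section Separated

variable {R K : CommRingCat.{u}} [IsLocalRing R] {ι : R ⟶ K} {g g' : Spec R ⟶ X} {i l : σ}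

lemma eq_of_closedPoint_mem_range_chart (H : IsLocalBlowUp V f) (hι : Function.Injective ι.hom)
    (e : Spec.map ι ≫ g = Spec.map ι ≫ g')
    (h : g (IsLocalRing.closedPoint R) ∈ Set.range (H.chart i))
    (h' : g' (IsLocalRing.closedPoint R) ∈ Set.range (H.chart i)) : g = g' := by
  obtain ⟨s, ψ, hsψ, rfl⟩ := H.exists_comp_chart_eq_of_closedPoint_mem h
  obtain ⟨s', ψ', hsψ', rfl⟩ := H.exists_comp_chart_eq_of_closedPoint_mem h'
  have hs : Spec.map ι ≫ s = Spec.map ι ≫ s' := by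
    rw [← cancel_mono (H.chart i), Category.assoc, Category.assoc, e]
  have hψι : ψ ≫ ι = ψ' ≫ ι := by
    apply Spec.map_injective
    rw [Spec.map_comp, Spec.map_comp, ← hsψ, ← hsψ', reassoc_of% hs]
  have hψ : ψ = ψ' := CommRingCat.hom_ext (RingHom.ext fun a ↦ hι congr($(hψι).hom a))
  have hss' : s = s' := by rw [← cancel_mono (chartOpens V i).ι, hsψ, hsψ', hψ]
  rw [hss']

lemma closedPoint_mem_range_chart [IsLocalRing K] (H : IsLocalBlowUp V f)
    (hι : Function.Injective ι.hom) (e : Spec.map ι ≫ g = Spec.map ι ≫ g')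
    (hi : g (IsLocalRing.closedPoint R) ∈ Set.range (H.chart i))
    (hl : g' (IsLocalRing.closedPoint R) ∈ Set.range (H.chart l)) :
    g (IsLocalRing.closedPoint R) ∈ Set.range (H.chart l) := by
  obtain rfl | hil := eq_or_ne i l
  · exact hi
  obtain ⟨s, ψ, hsψ, rfl⟩ := H.exists_comp_chart_eq_of_closedPoint_mem hi
  obtain ⟨s', ψ', hsψ', rfl⟩ := H.exists_comp_chart_eq_of_closedPoint_mem hl
  have hK : (ψ ≫ ι).hom (MvPolynomial.X l) * (ψ' ≫ ι).hom (MvPolynomial.X i) = 1 :=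
    H.mul_eq_one_of_comp_chart_eq hil (s := Spec.map ι ≫ s) (s' := Spec.map ι ≫ s')
      (by rw [Category.assoc, Category.assoc, e]) (by rw [Category.assoc, hsψ, Spec.map_comp])
      (by rw [Category.assoc, hsψ', Spec.map_comp])
  have hR : ψ.hom (MvPolynomial.X l) * ψ'.hom (MvPolynomial.X i) = 1 :=
    hι ((map_mul ι.hom _ _).trans (hK.trans (map_one ι.hom).symm))
  refine (H.chart_mem_range_chart_iff hil.symm _).mpr fun hmem ↦ ?_
  have hs : (chartOpens V i).ι (s (IsLocalRing.closedPoint R)) =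
      Spec.map ψ (IsLocalRing.closedPoint R) := congr($hsψ (IsLocalRing.closedPoint R))
  have hψ : ψ.hom (MvPolynomial.X l) ∈ (IsLocalRing.closedPoint R).asIdeal :=
    (congrArg PrimeSpectrum.asIdeal hs).le hmem
  exact (IsLocalRing.closedPoint R).2.ne_top
    (Ideal.eq_top_of_isUnit_mem _ hψ (IsUnit.of_mul_eq_one _ hR))

end Separated

omit [DecidableEq σ] in
lemma isSeparated [Finite σ] [IsNoetherianRing k] (H : IsLocalBlowUp V f) : IsSeparated f := by
  classical
  have := H.locallyOfFiniteType
  have : IsLocallyNoetherian X := LocallyOfFiniteType.isLocallyNoetherian f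
  refine IsSeparated.of_valuativeCriterion f fun S ↦ ⟨fun ⟨g, hg, _⟩ ⟨g', hg', _⟩ ↦ ?_⟩
  suffices g = g' by subst this; rfl
  have hι : Function.Injective (CommRingCat.ofHom (algebraMap S.R S.K)).hom :=
    IsFractionRing.injective S.R S.K
  obtain ⟨i, hi⟩ := H.exists_mem_range_chart (g (IsLocalRing.closedPoint S.R))
  obtain ⟨l, hl⟩ := H.exists_mem_range_chart (g' (IsLocalRing.closedPoint S.R))
  have e := hg.trans hg'.symm
  exact H.eq_of_closedPoint_mem_range_chart (R := .of S.R) (K := .of S.K) hι e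
    (H.closedPoint_mem_range_chart (R := .of S.R) (K := .of S.K) hι e hi hl) hl

end IsLocalBlowUp

end IsLocalBlowUp

section Origin

variable {k : Type u} [CommRing k] {σ : Type}

lemma ker_constantCoeff {R : Type*} [CommRing R] {ι : Type*} :
    RingHom.ker (MvPolynomial.constantCoeff : MvPolynomial ι R →+* R) =
      MvPolynomial.idealOfVars ι R := by
  ext p
  rw [← pow_one (MvPolynomial.idealOfVars ι R), MvPolynomial.mem_pow_idealOfVars_iff']
  simp [MvPolynomial.constantCoeff_eq, Finsupp.degree_eq_zero_iff]

/-- Evaluation of polynomials at the origin of affine space. -/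
def evalOrigin (k : Type u) [CommRing k] (σ : Type) : polyRing k σ ⟶ .of k :=
  CommRingCat.ofHom MvPolynomial.constantCoeff

lemma evalOrigin_X (l : σ) : (evalOrigin k σ).hom (MvPolynomial.X l) = 0 :=
  MvPolynomial.constantCoeff_X k l

lemma evalOrigin_C (a : k) : (evalOrigin k σ).hom (MvPolynomial.C a) = a :=
  MvPolynomial.constantCoeff_C σ a

lemma ker_specMap_evalOrigin : (Spec.map (evalOrigin k σ)).ker = originIdeal k σ := by
  rw [ker_specMap]
  exact congrArg (specIdeal (R := polyRing k σ)) ker_constantCoeff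

end Origin

section IdealSheaf

variable {T X Y : Scheme.{u}}

lemma comap_iInf_of_isOpenImmersion {ι : Type*} [Finite ι]
    (I : ι → Y.IdealSheafData) (f : X ⟶ Y) [IsOpenImmersion f] :
    (⨅ i, I i).comap f = ⨅ i, (I i).comap f := by
  refine Scheme.IdealSheafData.ext (funext fun U ↦ ?_)
  rw [Scheme.IdealSheafData.ideal_comap_of_isOpenImmersion, Scheme.IdealSheafData.ideal_iInf,
    Scheme.IdealSheafData.ideal_iInf, iInf_apply, iInf_apply, Ideal.comap_iInf]
  simp_rw [Scheme.IdealSheafData.ideal_comap_of_isOpenImmersion]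

lemma ker_comp_comap_of_isOpenImmersion (g : T ⟶ X) (f : X ⟶ Y) [IsOpenImmersion f]
    [QuasiCompact (g ≫ f)] : (g ≫ f).ker.comap f = g.ker := by
  have hpull : IsPullback (𝟙 T) g (g ≫ f) f :=
    ⟨⟨Category.id_comp _⟩, ⟨PullbackCone.IsLimit.mk _ (fun s ↦ s.fst)
      (fun s ↦ Category.comp_id _)
      (fun s ↦ by rw [← cancel_mono f, Category.assoc, s.condition])
      (fun s m h _ ↦ by rw [← h, Category.comp_id])⟩⟩
  refine Scheme.IdealSheafData.ext (funext fun U ↦ ?_)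
  rw [Scheme.IdealSheafData.ideal_comap_of_isOpenImmersion]
  exact (Scheme.ker_ideal_of_isPullback_of_isOpenImmersion (g ≫ f) g (𝟙 T) f hpull.flip U).symm

lemma comap_ker_eq_top_of_disjoint (g : T ⟶ Y) [IsClosedImmersion g] (f : X ⟶ Y)
    (h : ∀ x, f x ∉ Set.range g) : g.ker.comap f = ⊤ := by
  rw [← Scheme.IdealSheafData.support_eq_bot_iff, Scheme.IdealSheafData.support_comap]
  refine TopologicalSpace.Closeds.ext (Set.eq_empty_of_forall_notMem fun x hx ↦ h x ?_)
  have hfx : f x ∈ (g.ker.support : Set Y) := hx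
  rwa [Scheme.Hom.support_ker, g.isClosedEmbedding.isClosed_range.closure_eq] at hfx

lemma comap_eq_comap_of_forall_mem {I J : Y.IdealSheafData} {V : Y.Opens}
    (h : I.comap V.ι = J.comap V.ι) (g : T ⟶ Y) (hg : ∀ t, g t ∈ V) : I.comap g = J.comap g := by
  have hr : Set.range g ⊆ Set.range V.ι := by
    rw [Scheme.Opens.range_ι]
    exact Set.range_subset_iff.mpr hg
  rw [← IsOpenImmersion.lift_fac V.ι g hr, Scheme.IdealSheafData.comap_comp, h,
    ← Scheme.IdealSheafData.comap_comp]

end IdealSheaf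

section Restriction

variable {X Y U : Scheme.{u}} {π : X ⟶ Y} {I : Y.IdealSheafData}

lemma IsBlowUp.isIso_morphismRestrict (h : IsBlowUp π I) (U : Y.Opens) (hU : I.comap U.ι = ⊤) :
    IsIso (π ∣_ U) := by
  obtain ⟨g, hg, -⟩ := h.existsUnique_lift U.toScheme U.ι (by rw [hU]; exact isInvertibleIdeal_top)
  have hr : Set.range g ⊆ Set.range (π ⁻¹ᵁ U).ι := by
    rintro _ ⟨y, rfl⟩
    rw [Scheme.Opens.range_ι]
    change π (g y) ∈ U
    rw [← Scheme.Hom.comp_apply, hg]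
    exact y.2
  have e : π ∣_ U ≫ g = (π ⁻¹ᵁ U).ι := by
    refine (h.existsUnique_lift _ ((π ⁻¹ᵁ U).ι ≫ π) ?_).unique ?_ rfl
    · rw [Scheme.IdealSheafData.comap_comp]
      exact h.invertible.comap_of_isOpenImmersion _
    · rw [Category.assoc, hg, morphismRestrict_ι]
  refine ⟨IsOpenImmersion.lift _ g hr, ?_, ?_⟩
  · rw [← cancel_mono (π ⁻¹ᵁ U).ι, Category.assoc, IsOpenImmersion.lift_fac, e, Category.id_comp]
  · rw [← cancel_mono U.ι, Category.assoc, morphismRestrict_ι, IsOpenImmersion.lift_fac_assoc, hg,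
      Category.id_comp]

variable (c : U ⟶ Y) [IsOpenImmersion c] (V : U.Opens) (π : X ⟶ Y)

lemma range_ι_comp_subset : Set.range ((π ⁻¹ᵁ (c ''ᵁ V)).ι ≫ π) ⊆ Set.range c := by
  rintro _ ⟨x, rfl⟩
  obtain ⟨y, -, hy⟩ : π ((π ⁻¹ᵁ (c ''ᵁ V)).ι x) ∈ c ''ᵁ V := x.2
  rw [Scheme.Hom.comp_apply]
  exact ⟨y, hy⟩

/-- The restriction of `π : X ⟶ Y` over the open subset `V` of a chart `c : U ⟶ Y`, with values
in the chart. -/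
def restrictChart : (π ⁻¹ᵁ (c ''ᵁ V)).toScheme ⟶ U :=
  IsOpenImmersion.lift c ((π ⁻¹ᵁ (c ''ᵁ V)).ι ≫ π) (range_ι_comp_subset c V π)

lemma restrictChart_comp : restrictChart c V π ≫ c = (π ⁻¹ᵁ (c ''ᵁ V)).ι ≫ π :=
  IsOpenImmersion.lift_fac _ _ _

lemma restrictChart_mem (x : (π ⁻¹ᵁ (c ''ᵁ V)).toScheme) : restrictChart c V π x ∈ V := by
  obtain ⟨y, hy, hyx⟩ : π ((π ⁻¹ᵁ (c ''ᵁ V)).ι x) ∈ c ''ᵁ V := x.2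
  have hcy : c (restrictChart c V π x) = c y := by
    rw [← Scheme.Hom.comp_apply, restrictChart_comp, Scheme.Hom.comp_apply]
    exact hyx.symm
  rwa [c.isOpenEmbedding.injective hcy]

variable {c V π}

lemma IsBlowUp.existsUnique_restrictChart_lift (h : IsBlowUp π I) {T : Scheme.{u}} (g : T ⟶ U)
    (hg : ∀ t, g t ∈ V) (hi : IsInvertibleIdeal (I.comap (g ≫ c))) :
    ∃! s, s ≫ restrictChart c V π = g := by
  obtain ⟨s, hs, hu⟩ := h.existsUnique_lift T (g ≫ c) hi
  have hr : Set.range s ⊆ Set.range (π ⁻¹ᵁ (c ''ᵁ V)).ι := by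
    rw [Scheme.Opens.range_ι]
    exact Set.range_subset_iff.mpr fun t ↦ ⟨g t, hg t, congr($(hs.symm) t)⟩
  refine ⟨IsOpenImmersion.lift (π ⁻¹ᵁ (c ''ᵁ V)).ι s hr, ?_, fun s' hs' ↦ ?_⟩
  · dsimp only
    rw [← cancel_mono c, Category.assoc, restrictChart_comp, IsOpenImmersion.lift_fac_assoc, hs]
  · rw [← cancel_mono (π ⁻¹ᵁ (c ''ᵁ V)).ι, IsOpenImmersion.lift_fac]
    refine hu _ ?_
    dsimp only
    rw [Category.assoc, ← restrictChart_comp, reassoc_of% hs']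

lemma IsBlowUp.isLocalBlowUp {k : Type u} [CommRing k] {σ : Type} (h : IsBlowUp π I)
    (c : Spec (polyRing k σ) ⟶ Y) [IsOpenImmersion c] {V : (Spec (polyRing k σ)).Opens}
    (hc : I.comap (V.ι ≫ c) = (originIdeal k σ).comap V.ι) :
    IsLocalBlowUp V (restrictChart c V π) := by
  have hcomap {T : Scheme.{u}} (g : T ⟶ Spec (polyRing k σ)) (hg : ∀ t, g t ∈ V) :
      (originIdeal k σ).comap g = I.comap (g ≫ c) := by
    rw [Scheme.IdealSheafData.comap_comp] at hc ⊢
    exact comap_eq_comap_of_forall_mem hc.symm g hg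
  refine ⟨restrictChart_mem c V π, ?_, fun T g hg hi ↦ ?_⟩
  · rw [hcomap _ (restrictChart_mem c V π), restrictChart_comp, Scheme.IdealSheafData.comap_comp]
    exact h.invertible.comap_of_isOpenImmersion _
  · exact h.existsUnique_restrictChart_lift g hg (hcomap g hg ▸ hi)

end Restriction

/-! ### Standard charts of projective space -/

section ProjectiveSpace

lemma map_eq_pow_mul_of_isHomogeneous {R σ L : Type*} [CommSemiring R] [CommSemiring L]
    {F : MvPolynomial σ R} {d : ℕ} (hF : F.IsHomogeneous d)
    {φ ψ : MvPolynomial σ R →+* L} {c : L}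
    (hC : ∀ a, ψ (MvPolynomial.C a) = φ (MvPolynomial.C a))
    (hX : ∀ l, ψ (MvPolynomial.X l) = c * φ (MvPolynomial.X l)) : ψ F = c ^ d * φ F := by
  rw [F.as_sum, map_sum, map_sum, Finset.mul_sum]
  refine Finset.sum_congr rfl fun m hm ↦ ?_
  have hd : ∑ i ∈ m.support, m i = d := (hF.degree_eq_sum_deg_support hm).symm
  rw [MvPolynomial.monomial_eq, map_mul, map_mul, hC, Finsupp.prod, map_prod, map_prod]
  simp_rw [map_pow, hX, mul_pow]
  rw [Finset.prod_mul_distrib, Finset.prod_pow_eq_pow_sum, hd, mul_left_comm]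

variable (k : Type u) [CommRing k] {n : ℕ}

attribute [local instance] MvPolynomial.gradedAlgebra

open HomogeneousLocalization

/-- The homogeneous coordinate ring of `ℙⁿ`. -/
abbrev CoordRing (n : ℕ) : Type u := MvPolynomial (Fin (n + 1)) k

/-- The grading by degree on the homogeneous coordinate ring of `ℙⁿ`. -/
abbrev projGrading (n : ℕ) : ℕ → Submodule k (CoordRing k n) :=
  MvPolynomial.homogeneousSubmodule (Fin (n + 1)) k

lemma X_mem_projGrading_one (i : Fin (n + 1)) :
    (MvPolynomial.X i : CoordRing k n) ∈ projGrading k n 1 :=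
  MvPolynomial.isHomogeneous_X k i

/-- The ring of functions on the affine open subset `D₊(X i)` of `ℙⁿ`. -/
abbrev AwayX (i : Fin (n + 1)) : Type u :=
  Away (projGrading k n) (MvPolynomial.X i : CoordRing k n)

/-- The localization `k[X₀, …, Xₙ][1 / X i]`, which contains the functions on `D₊(X i)` as its
part of degree zero. -/
abbrev LocalizationX (i : Fin (n + 1)) : Type u :=
  Localization.Away (MvPolynomial.X i : CoordRing k n)

/-- The substitution of the functions `X (i.succAbove j) / X i` on `D₊(X i)` for the coordinates
`X j` of affine space. -/
def toAway (i : Fin (n + 1)) : MvPolynomial (Fin n) k →+* AwayX k i :=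
  MvPolynomial.eval₂Hom
    ((fromZeroRingHom (projGrading k n) _).comp (algebraMap k (projGrading k n 0)))
    (fun j ↦ Away.mk (projGrading k n) (X_mem_projGrading_one k i) 1
      (MvPolynomial.X (i.succAbove j)) (X_mem_projGrading_one k _))

lemma toAway_C (i : Fin (n + 1)) (a : k) : toAway k i (MvPolynomial.C a) =
    fromZeroRingHom (projGrading k n) _ (algebraMap k (projGrading k n 0) a) :=
  MvPolynomial.eval₂Hom_C _ _ a

lemma toAway_X (i : Fin (n + 1)) (j : Fin n) : toAway k i (MvPolynomial.X j) =
    Away.mk (projGrading k n) (X_mem_projGrading_one k i) 1 (MvPolynomial.X (i.succAbove j))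
      (X_mem_projGrading_one k _) :=
  MvPolynomial.eval₂Hom_X' _ _ j

lemma val_toAway_C (i : Fin (n + 1)) (a : k) :
    algebraMap (AwayX k i) (LocalizationX k i) (toAway k i (MvPolynomial.C a)) =
      algebraMap (CoordRing k n) (LocalizationX k i) (MvPolynomial.C a) := by
  rw [toAway_C]
  rfl

lemma algebraMap_X_mul_val_toAway_X (i : Fin (n + 1)) (j : Fin n) :
    algebraMap (CoordRing k n) (LocalizationX k i) (MvPolynomial.X i) *
      algebraMap (AwayX k i) (LocalizationX k i) (toAway k i (MvPolynomial.X j)) =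
    algebraMap (CoordRing k n) (LocalizationX k i) (MvPolynomial.X (i.succAbove j)) := by
  rw [toAway_X, HomogeneousLocalization.algebraMap_apply, Away.val_mk, Localization.mk_eq_mk',
    mul_comm]
  have h := IsLocalization.mk'_spec (LocalizationX k i) (MvPolynomial.X (i.succAbove j))
    (⟨MvPolynomial.X i ^ 1, 1, rfl⟩ :
      Submonoid.powers (MvPolynomial.X i : CoordRing k n))
  simpa only [pow_one] using h

/-- Setting the `i`-th homogeneous coordinate to one. -/
def dehomogenize (i : Fin (n + 1)) : CoordRing k n →+* MvPolynomial (Fin n) k :=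
  MvPolynomial.eval₂Hom MvPolynomial.C (i.insertNth 1 MvPolynomial.X)

lemma dehomogenize_X_self (i : Fin (n + 1)) : dehomogenize k i (MvPolynomial.X i) = 1 := by
  rw [dehomogenize, MvPolynomial.eval₂Hom_X', Fin.insertNth_apply_same]

lemma dehomogenize_X_succAbove (i : Fin (n + 1)) (j : Fin n) :
    dehomogenize k i (MvPolynomial.X (i.succAbove j)) = MvPolynomial.X j := by
  rw [dehomogenize, MvPolynomial.eval₂Hom_X', Fin.insertNth_apply_succAbove]

lemma dehomogenize_C (i : Fin (n + 1)) (a : k) :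
    dehomogenize k i (MvPolynomial.C a) = MvPolynomial.C a :=
  MvPolynomial.eval₂Hom_C _ _ a

lemma toAway_injective (i : Fin (n + 1)) : Function.Injective (toAway k i) := by
  have hu : IsUnit (dehomogenize k i (MvPolynomial.X i)) := by
    rw [dehomogenize_X_self]
    exact isUnit_one
  let r : LocalizationX k i →+* MvPolynomial (Fin n) k :=
    IsLocalization.Away.lift (MvPolynomial.X i) hu
  have hr (F : CoordRing k n) : r (algebraMap (CoordRing k n) _ F) = dehomogenize k i F :=
    IsLocalization.Away.lift_eq (MvPolynomial.X i) hu F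
  have h : (r.comp (algebraMap (AwayX k i) (LocalizationX k i))).comp (toAway k i) =
      RingHom.id _ := by
    refine MvPolynomial.ringHom_ext (fun a ↦ ?_) (fun j ↦ ?_)
    · rw [RingHom.comp_apply, RingHom.comp_apply, val_toAway_C, hr, dehomogenize_C,
        RingHom.id_apply]
    · have hX := congrArg r (algebraMap_X_mul_val_toAway_X k i j)
      rwa [map_mul, hr, hr, dehomogenize_X_self, one_mul, dehomogenize_X_succAbove] at hX
  exact Function.LeftInverse.injective (g := r.comp (algebraMap _ _)) fun x ↦ congr($h x)

lemma algebraMap_eq_pow_mul_val_toAway_dehomogenize (i : Fin (n + 1)) {d : ℕ}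
    {F : CoordRing k n} (hF : F.IsHomogeneous d) :
    algebraMap (CoordRing k n) (LocalizationX k i) F =
      algebraMap (CoordRing k n) (LocalizationX k i) (MvPolynomial.X i) ^ d *
        algebraMap (AwayX k i) (LocalizationX k i) (toAway k i (dehomogenize k i F)) := by
  refine map_eq_pow_mul_of_isHomogeneous hF (ψ := algebraMap (CoordRing k n) (LocalizationX k i))
    (φ := ((algebraMap (AwayX k i) (LocalizationX k i)).comp (toAway k i)).comp (dehomogenize k i))
    (fun a ↦ ?_) (fun l ↦ ?_)
  · rw [RingHom.comp_apply, RingHom.comp_apply, dehomogenize_C, val_toAway_C]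
  · rw [RingHom.comp_apply, RingHom.comp_apply]
    obtain rfl | ⟨j, rfl⟩ := Fin.eq_self_or_eq_succAbove i l
    · rw [dehomogenize_X_self, map_one, map_one, mul_one]
    · rw [dehomogenize_X_succAbove, algebraMap_X_mul_val_toAway_X]

lemma toAway_surjective (i : Fin (n + 1)) : Function.Surjective (toAway k i) := by
  intro z
  obtain ⟨d, F, hF, rfl⟩ := Away.mk_surjective (projGrading k n) (X_mem_projGrading_one k i) z
  have hF' : F.IsHomogeneous d := by simpa using hF
  refine ⟨dehomogenize k i F, HomogeneousLocalization.val_injective _ ?_⟩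
  rw [Away.val_mk, Localization.mk_eq_mk', eq_comm, IsLocalization.mk'_eq_iff_eq_mul,
    algebraMap_eq_pow_mul_val_toAway_dehomogenize k i hF', mul_comm, map_pow,
    HomogeneousLocalization.algebraMap_apply]

/-- The isomorphism between the ring of functions on affine space and on `D₊(X i)`. -/
def awayIso (i : Fin (n + 1)) : polyRing k (Fin n) ≅ .of (AwayX k i) :=
  (RingEquiv.ofBijective (toAway k i)
    ⟨toAway_injective k i, toAway_surjective k i⟩).toCommRingCatIso

/-- The standard affine chart `D₊(X i)` of projective space. -/
def projChart (i : Fin (n + 1)) : Spec (polyRing k (Fin n)) ⟶ Proj (projGrading k n) :=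
  Spec.map (awayIso k i).inv ≫
    Proj.awayι (projGrading k n) (MvPolynomial.X i) (X_mem_projGrading_one k i) one_pos

instance isOpenImmersion_projChart (i : Fin (n + 1)) : IsOpenImmersion (projChart k i) := by
  delta projChart
  infer_instance

lemma range_projChart (i : Fin (n + 1)) :
    Set.range (projChart k i) = Proj.basicOpen (projGrading k n) (MvPolynomial.X i) := by
  have hs : Function.Surjective (Spec.map (awayIso k i).inv) :=
    (Spec.map (awayIso k i).inv).homeomorph.surjective
  rw [← Proj.opensRange_awayι (projGrading k n) (MvPolynomial.X i)
    (X_mem_projGrading_one k i) one_pos,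
    projChart, Scheme.Hom.comp_base, TopCat.coe_comp, Set.range_comp,
    hs.range_eq, Set.image_univ]
  rfl

lemma isLocalizationElem_X (i : Fin (n + 1)) (j : Fin n) :
    Away.isLocalizationElem (X_mem_projGrading_one k i)
      (X_mem_projGrading_one k (i.succAbove j)) = toAway k i (MvPolynomial.X j) := by
  rw [toAway_X]
  apply HomogeneousLocalization.val_injective
  simp [Away.isLocalizationElem]

lemma projChart_mem_basicOpen_iff (i : Fin (n + 1)) (j : Fin n)
    (y : Spec (polyRing k (Fin n))) :
    projChart k i y ∈ Proj.basicOpen (projGrading k n) (MvPolynomial.X (i.succAbove j)) ↔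
      (MvPolynomial.X j : MvPolynomial (Fin n) k) ∉ PrimeSpectrum.asIdeal y := by
  have hpre := Proj.awayι_preimage_basicOpen (projGrading k n) (X_mem_projGrading_one k i) one_pos
    (X_mem_projGrading_one k (i.succAbove j)) one_pos
  rw [isLocalizationElem_X] at hpre
  refine (SetLike.ext_iff.mp hpre (Spec.map (awayIso k i).inv y)).trans ?_
  change (awayIso k i).inv ((awayIso k i).hom (MvPolynomial.X j)) ∉ y.asIdeal ↔ _
  rw [CategoryTheory.Iso.hom_inv_id_apply]

lemma projChart_toSpecZero (i : Fin (n + 1)) :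
    projChart k i ≫ Proj.toSpecZero (projGrading k n) ≫
        Spec.map (CommRingCat.ofHom (algebraMap k (projGrading k n 0))) =
      Spec.map (CommRingCat.ofHom MvPolynomial.C) := by
  rw [projChart, Category.assoc, Proj.awayι_toSpecZero_assoc, ← Spec.map_comp, ← Spec.map_comp]
  congr 1
  rw [Iso.comp_inv_eq]
  exact CommRingCat.hom_ext (RingHom.ext fun a ↦ (toAway_C k i a).symm)

lemma exists_mem_range_projChart (x : Proj (projGrading k n)) :
    ∃ i, x ∈ Set.range (projChart k i) := by
  have hadjoin : Algebra.adjoin (projGrading k n 0)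
      (Set.range (MvPolynomial.X : Fin (n + 1) → MvPolynomial _ k)) = ⊤ := by
    refine eq_top_iff.mpr fun F _ ↦ ?_
    induction F using MvPolynomial.induction_on with
    | C a => exact Subalgebra.algebraMap_mem _ (algebraMap k (projGrading k n 0) a)
    | add p q hp hq => exact add_mem (hp trivial) (hq trivial)
    | mul_X p i hp => exact mul_mem (hp trivial) (Algebra.subset_adjoin ⟨i, rfl⟩)
  obtain ⟨i, hi⟩ := TopologicalSpace.Opens.mem_iSup.mp
    ((Proj.iSup_basicOpen_eq_top' (projGrading k n) MvPolynomial.X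
      (fun i ↦ ⟨1, X_mem_projGrading_one k i⟩) hadjoin).ge (Set.mem_univ x))
  exact ⟨i, by rwa [range_projChart]⟩

end ProjectiveSpace

/-! ### Classes of stratified varieties -/

lemma range_eq_preimage_range_comp {X Y Z : Scheme.{u}} (f : X ⟶ Y) {g : Y ⟶ Z}
    (hg : Function.Injective g) : Set.range f = g ⁻¹' Set.range (f ≫ g) := by
  rw [Scheme.Hom.comp_base, TopCat.coe_comp, Set.range_comp, hg.preimage_image]

section Stratification

variable {k : Type u} [Field k]

namespace Variety

lemma isNoetherian (X : Variety k) : AlgebraicGeometry.IsNoetherian X.toOver.left := by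
  have := X.isVariety.locallyOfFiniteType
  have := X.isVariety.quasiCompact
  have : IsLocallyNoetherian X.toOver.left :=
    LocallyOfFiniteType.isLocallyNoetherian X.toOver.hom
  have : CompactSpace X.toOver.left := QuasiCompact.compactSpace_of_compactSpace X.toOver.hom
  exact {}

/-- An open subvariety. -/
def restrict (X : Variety k) (U : X.toOver.left.Opens) : Variety k where
  toOver := Over.mk (U.ι ≫ X.toOver.hom)
  isVariety := by
    have := X.isNoetherian
    obtain ⟨h₁, h₂, h₃, h₄⟩ := X.isVariety
    have : TopologicalSpace.NoetherianSpace U.toScheme :=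
      inferInstanceAs (TopologicalSpace.NoetherianSpace (U : Set X.toOver.left))
    exact ⟨isReduced_of_isOpenImmersion U.ι, by dsimp; infer_instance, by dsimp; infer_instance,
      by dsimp; infer_instance⟩

/-- `Z` maps isomorphically onto the locally closed complement of `U` in a larger open subset `U'`
of `X`. (`Z` is reduced, so a preimmersion with this image suffices.) -/
def IsStratum (Z X : Variety k) (U U' : X.toOver.left.Opens) : Prop :=
  U ≤ U' ∧ ∃ i : Z.toOver ⟶ X.toOver, IsPreimmersion i.left ∧
    Set.range i.left = (U' : Set X.toOver.left) \ U

end Variety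

namespace K0Var

lemma mk_eq_of_rel {a b : FreeCommRing (Variety k)} (h : K0Rel k a b) :
    Ideal.Quotient.mk (Ideal.ofRel (K0Rel k)) a = Ideal.Quotient.mk _ b :=
  Ideal.Quotient.eq.mpr (Ideal.subset_span ⟨a, b, h, sub_add_cancel a b⟩)

lemma cls_eq_of_iso {X Y : Variety k} (e : X.toOver ≅ Y.toOver) : cls X = cls Y :=
  mk_eq_of_rel (.iso X Y e)

lemma cls_eq_add (X Z U : Variety k) (i : Z.toOver ⟶ X.toOver) (j : U.toOver ⟶ X.toOver)
    (hi : IsClosedImmersion i.left) (hj : IsOpenImmersion j.left)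
    (h : IsCompl (Set.range i.left) (Set.range j.left)) : cls X = cls Z + cls U :=
  (mk_eq_of_rel (.scissor X Z U i j hi hj h)).trans (map_add _ _ _)

lemma cls_eq_mul (X Y P : Variety k) (fst : P.toOver ⟶ X.toOver) (snd : P.toOver ⟶ Y.toOver)
    (h : IsPullback fst.left snd.left X.toOver.hom Y.toOver.hom) : cls P = cls X * cls Y :=
  (mk_eq_of_rel (.prod X Y P fst snd h)).trans (map_mul _ _ _)

lemma cls_eq_one (X : Variety k) (h : IsIso X.toOver.hom) : cls X = 1 :=
  (mk_eq_of_rel (.point X h)).trans (map_one _)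

lemma cls_restrict_eq_add {X Z : Variety k} {U U' : X.toOver.left.Opens}
    (h : Z.IsStratum X U U') : cls (X.restrict U') = cls (X.restrict U) + cls Z := by
  obtain ⟨hU, i, hi, hr⟩ := h
  have hrU' : Set.range i.left ⊆ Set.range U'.ι := by
    rw [hr, Scheme.Opens.range_ι]
    exact Set.sdiff_subset
  let i' : Z.toOver.left ⟶ U'.toScheme := IsOpenImmersion.lift U'.ι i.left hrU'
  have hi' : i' ≫ U'.ι = i.left := IsOpenImmersion.lift_fac _ _ _
  have hinj : Function.Injective U'.ι := U'.ι.isOpenEmbedding.injective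
  have hri : Set.range i' = (U'.ι ⁻¹' (U : Set X.toOver.left))ᶜ := by
    rw [range_eq_preimage_range_comp i' hinj, hi', hr, Set.preimage_sdiff, Set.compl_eq_univ_sdiff,
      Set.preimage_eq_univ_iff.mpr (Scheme.Opens.range_ι U').le]
  have hrj : Set.range (X.toOver.left.homOfLE hU) = U'.ι ⁻¹' (U : Set X.toOver.left) := by
    rw [range_eq_preimage_range_comp _ hinj, Scheme.homOfLE_ι, Scheme.Opens.range_ι]
  have : IsPreimmersion (i' ≫ U'.ι) := hi' ▸ hi
  have : IsPreimmersion i' := .of_comp _ U'.ι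
  have hclosed : IsClosedImmersion i' := .of_isPreimmersion i'
    (hri ▸ (U.2.preimage U'.ι.continuous).isClosed_compl)
  have hi'k : i' ≫ U'.ι ≫ X.toOver.hom = Z.toOver.hom := by rw [reassoc_of% hi', Over.w i]
  have hjk : X.toOver.left.homOfLE hU ≫ U'.ι ≫ X.toOver.hom = U.ι ≫ X.toOver.hom := by
    rw [Scheme.homOfLE_ι_assoc]
  rw [add_comm]
  refine cls_eq_add (X.restrict U') Z (X.restrict U) (Over.homMk i' hi'k)
    (Over.homMk (X.toOver.left.homOfLE hU) hjk) hclosed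
    (inferInstanceAs (IsOpenImmersion (X.toOver.left.homOfLE hU))) ?_
  change IsCompl (Set.range i') (Set.range (X.toOver.left.homOfLE hU))
  rw [hri, hrj]
  exact isCompl_compl.symm

lemma cls_restrict_eq_sum {X : Variety k} {N : ℕ} {Z : Fin N → Variety k}
    {U : ℕ → X.toOver.left.Opens} (h : ∀ m : Fin N, (Z m).IsStratum X (U m) (U (m + 1))) :
    cls (X.restrict (U N)) = cls (X.restrict (U 0)) + ∑ m, cls (Z m) := by
  induction N with
  | zero => rw [Fin.sum_univ_zero, add_zero]
  | succ N ih =>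
    rw [Fin.sum_univ_castSucc, ← add_assoc, ← ih fun m ↦ h m.castSucc]
    exact cls_restrict_eq_add (h (Fin.last N))

lemma cls_restrict_top (X : Variety k) : cls (X.restrict ⊤) = cls X :=
  cls_eq_of_iso (Over.isoMk (Scheme.topIso _) rfl)

lemma cls_restrict_bot (X : Variety k) : cls (X.restrict ⊥) = 0 := by
  have h : (X.restrict ⊥).IsStratum X ⊥ ⊥ := by
    refine ⟨le_rfl, Over.homMk (⊥ : X.toOver.left.Opens).ι rfl,
      inferInstanceAs (IsPreimmersion (⊥ : X.toOver.left.Opens).ι), ?_⟩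
    rw [sdiff_self]
    exact Scheme.Opens.range_ι _
  exact left_eq_add.mp (cls_restrict_eq_add h)

end K0Var

end Stratification

section AffineSpace

variable {k : Type u} [Field k]

/-- The spectrum of a reduced `k`-algebra of finite type. -/
def Variety.spec (k : Type u) [Field k] (A : Type u) [CommRing A] [Algebra k A]
    [Algebra.FiniteType k A] [_root_.IsReduced A] : Variety k where
  toOver := Over.mk (Spec.map (CommRingCat.ofHom (algebraMap k A)))
  isVariety := by
    refine ⟨?_, ?_, ?_, ?_⟩
    · dsimp; infer_instance
    · dsimp; infer_instance
    · refine (HasRingHomProperty.Spec_iff (P := @LocallyOfFiniteType)).mpr ?_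
      exact RingHom.finiteType_algebraMap.mpr inferInstance
    · dsimp; infer_instance

/-- The affine space with coordinates indexed by `σ`. -/
def affineSpace (k : Type u) [Field k] (σ : Type) [Finite σ] : Variety k :=
  Variety.spec k (MvPolynomial σ k)

namespace K0Var

section

variable {A : Type u} [CommRing A] [Algebra k A] [Algebra.FiniteType k A] [_root_.IsReduced A]

lemma cls_spec_congr {B : Type u} [CommRing B] [Algebra k B] [Algebra.FiniteType k B]
    [_root_.IsReduced B] (e : A ≃ₐ[k] B) :
    cls (Variety.spec k A) = cls (Variety.spec k B) := by
  refine cls_eq_of_iso (Over.isoMk (Scheme.Spec.mapIso e.symm.toRingEquiv.toCommRingCatIso.op) ?_)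
  change Spec.map (CommRingCat.ofHom (e.symm : B →+* A)) ≫ Spec.map _ = Spec.map _
  rw [← Spec.map_comp]
  congr 1
  ext a
  exact e.symm.commutes a

variable (k) in
lemma cls_spec_self : cls (Variety.spec k k) = 1 := by
  refine cls_eq_one _ ?_
  change IsIso (Spec.map (CommRingCat.ofHom (RingHom.id k)))
  have : IsIso (CommRingCat.ofHom (RingHom.id k)) := inferInstanceAs (IsIso (𝟙 (CommRingCat.of k)))
  infer_instance

variable (A) in
attribute [local instance] Polynomial.algebra in
lemma cls_spec_polynomial [_root_.IsReduced (Polynomial A)] :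
    cls (Variety.spec k (Polynomial A)) = cls (Variety.spec k A) * lefschetz k := by
  refine cls_eq_mul (Variety.spec k A) (affineLine k) _
    (Over.homMk (Spec.map (CommRingCat.ofHom (algebraMap A (Polynomial A)))) ?_)
    (Over.homMk (Spec.map (CommRingCat.ofHom (algebraMap (Polynomial k) (Polynomial A)))) ?_) ?_
  · change Spec.map _ ≫ Spec.map _ = Spec.map _
    rw [← Spec.map_comp, ← CommRingCat.ofHom_comp, ← IsScalarTower.algebraMap_eq]
  · change Spec.map _ ≫ Spec.map _ = Spec.map _
    rw [← Spec.map_comp, ← CommRingCat.ofHom_comp, ← IsScalarTower.algebraMap_eq]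
  · exact isPullback_SpecMap_of_isPushout _ _ _ _
      (CommRingCat.isPushout_of_isPushout k A (Polynomial k) (Polynomial A))

end

lemma cls_affineSpace_fin (n : ℕ) : cls (affineSpace k (Fin n)) = lefschetz k ^ n := by
  rw [affineSpace]
  induction n with
  | zero => rw [cls_spec_congr (MvPolynomial.isEmptyAlgEquiv k (Fin 0)), cls_spec_self, pow_zero]
  | succ n ih =>
    rw [cls_spec_congr (MvPolynomial.finSuccEquiv k n), cls_spec_polynomial, ih, pow_succ]

lemma cls_affineSpace (σ : Type) [Finite σ] :
    cls (affineSpace k σ) = lefschetz k ^ Nat.card σ := by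
  rw [affineSpace, cls_spec_congr (MvPolynomial.renameEquiv k (Finite.equivFin σ))]
  exact cls_affineSpace_fin _

lemma cls_affineSpace_ge (n m : ℕ) :
    cls (affineSpace k {j : Fin n | m ≤ j}) = lefschetz k ^ (n - m) := by
  have hcard : Nat.card {j : Fin n | m ≤ j} = n - m := by
    have himage : Fin.val '' {j : Fin n | m ≤ j} = Finset.Ico m n := by
      ext l
      simp [Fin.exists_iff, and_comm]
    rw [← Nat.card_image_of_injective Fin.val_injective, himage,
      Nat.card_coe_set_eq, Set.ncard_coe_finset, Nat.card_Ico]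
  rw [cls_affineSpace, hcard]

end K0Var

end AffineSpace

section CoordSubspace

lemma killCompl_X_of_notMem {R σ τ : Type*} [CommRing R] {f : σ → τ} (hf : Function.Injective f)
    {j : τ} (hj : j ∉ Set.range f) : MvPolynomial.killCompl (R := R) hf (MvPolynomial.X j) = 0 := by
  rw [MvPolynomial.killCompl, MvPolynomial.aeval_X, dif_neg hj]

lemma ker_killCompl {R σ τ : Type*} [CommRing R] {f : σ → τ} (hf : Function.Injective f) :
    RingHom.ker (MvPolynomial.killCompl (R := R) hf) =
      Ideal.span (MvPolynomial.X '' (Set.range f)ᶜ) := by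
  refine le_antisymm (fun p hp ↦ ?_) ?_
  · rw [MvPolynomial.mem_ideal_span_X_image]
    by_contra! h
    obtain ⟨m, hm, hm0⟩ := h
    have hsupp : ↑m.support ⊆ Set.range f := fun j hj ↦
      by_contra fun hjf ↦ Finsupp.mem_support_iff.mp hj (hm0 j hjf)
    have hcoeff := MvPolynomial.coeff_killCompl hf (p := p) (s := m.comapDomain f hf.injOn)
    rw [(RingHom.mem_ker).mp hp, m.mapDomain_comapDomain f hf hsupp] at hcoeff
    exact MvPolynomial.mem_support_iff.mp hm hcoeff.symm
  · rw [Ideal.span_le]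
    rintro _ ⟨j, hj, rfl⟩
    exact killCompl_X_of_notMem hf hj

variable (k : Type u) [CommRing k] {σ : Type} (s : Set σ)

/-- The inclusion of the linear subspace on which the coordinates outside `s` vanish. -/
def coordSubspace : Spec (polyRing k s) ⟶ Spec (polyRing k σ) :=
  Spec.map (CommRingCat.ofHom (MvPolynomial.killCompl Subtype.val_injective).toRingHom)

lemma killCompl_subtype_surjective : Function.Surjective
    (MvPolynomial.killCompl (R := k) (Subtype.val_injective (p := (· ∈ s)))) :=
  fun p ↦ ⟨_, MvPolynomial.killCompl_rename_app _ p⟩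

instance isClosedImmersion_coordSubspace : IsClosedImmersion (coordSubspace k s) :=
  IsClosedImmersion.spec_of_surjective _ (killCompl_subtype_surjective k s)

lemma coordSubspace_comp : coordSubspace k s ≫ Spec.map (CommRingCat.ofHom MvPolynomial.C) =
    Spec.map (CommRingCat.ofHom MvPolynomial.C) := by
  rw [coordSubspace, ← Spec.map_comp]
  congr 1
  exact CommRingCat.hom_ext (RingHom.ext (MvPolynomial.killCompl_C _))

lemma mem_range_coordSubspace_iff (y : Spec (polyRing k σ)) :
    y ∈ Set.range (coordSubspace k s) ↔
      ∀ j ∉ s, (MvPolynomial.X j : MvPolynomial σ k) ∈ PrimeSpectrum.asIdeal y := by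
  have h : Set.range (coordSubspace k s) = PrimeSpectrum.zeroLocus (RingHom.ker
      (MvPolynomial.killCompl (R := k) (Subtype.val_injective (p := (· ∈ s)))) :
      Set (polyRing k σ)) :=
    range_comap_of_surjective _ _ (killCompl_subtype_surjective k s)
  rw [h, ker_killCompl, PrimeSpectrum.zeroLocus_span, Subtype.range_val]
  exact Set.image_subset_iff

end CoordSubspace

lemma isVariety_of_openCover {k : Type u} [Field k] {X : Over (Spec (.of k))}
    (𝒰 : Scheme.OpenCover.{0} X.left) [Finite 𝒰.I₀] [∀ i, IsReduced (𝒰.X i)]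
    [∀ i, CompactSpace (𝒰.X i)] (hft : ∀ i, LocallyOfFiniteType (𝒰.f i ≫ X.hom))
    (hs : IsSeparated X.hom) : IsVariety X := by
  have : CompactSpace X.left := Scheme.OpenCover.compactSpace 𝒰
  exact ⟨IsReduced.of_openCover _ 𝒰, hs, IsZariskiLocalAtSource.of_openCover 𝒰 hft, inferInstance⟩

instance locallyOfFiniteType_specMap_C (k : Type u) [CommRing k] (σ : Type) [Finite σ] :
    LocallyOfFiniteType
      (Spec.map (CommRingCat.ofHom (MvPolynomial.C : k →+* MvPolynomial σ k))) :=
  (HasRingHomProperty.Spec_iff (P := @LocallyOfFiniteType)).mpr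
    (RingHom.finiteType_algebraMap.mpr inferInstance)

section ProjSpace

attribute [local instance] MvPolynomial.gradedAlgebra

variable (k : Type u) [Field k] {n : ℕ}

/-- The cover of projective space by its standard affine charts. -/
def projCover (n : ℕ) : Scheme.OpenCover.{0} (Proj (projGrading k n)) :=
  .mkOfCovers (Fin (n + 1)) _ (projChart k) (exists_mem_range_projChart k)
    (isOpenImmersion_projChart k)

/-- Projective space as a variety. -/
def projSpace (n : ℕ) : Variety k where
  toOver := Over.mk (Y := Proj (projGrading k n))
    (Proj.toSpecZero (projGrading k n) ≫
      Spec.map (CommRingCat.ofHom (algebraMap k (projGrading k n 0))))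
  isVariety := by
    have : Finite (projCover k n).I₀ := inferInstanceAs (Finite (Fin (n + 1)))
    have (i : (projCover k n).I₀) : IsReduced ((projCover k n).X i) :=
      inferInstanceAs (IsReduced (Spec (polyRing k (Fin n))))
    have (i : (projCover k n).I₀) : CompactSpace ((projCover k n).X i) :=
      inferInstanceAs (CompactSpace (Spec (polyRing k (Fin n))))
    exact isVariety_of_openCover (projCover k n)
      (fun i ↦ (projChart_toSpecZero k i).symm ▸ locallyOfFiniteType_specMap_C k (Fin n))
      (inferInstanceAs (IsSeparated (Proj.toSpecZero (projGrading k n) ≫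
        Spec.map (CommRingCat.ofHom (algebraMap k (projGrading k n 0))))))

/-- The standard affine charts of the variety `projSpace k n`. -/
def projSpaceChart (i : Fin (n + 1)) : Spec (polyRing k (Fin n)) ⟶ (projSpace k n).toOver.left :=
  projChart k i

/-- The complement of a coordinate hyperplane. -/
def coordOpen (i : Fin (n + 1)) : (projSpace k n).toOver.left.Opens :=
  Proj.basicOpen (projGrading k n) (MvPolynomial.X i)

instance isOpenImmersion_projSpaceChart (i : Fin (n + 1)) :
    IsOpenImmersion (projSpaceChart k i) :=
  isOpenImmersion_projChart k i

lemma range_projSpaceChart (i : Fin (n + 1)) :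
    Set.range (projSpaceChart k i) = (coordOpen k i : Set (projSpace k n).toOver.left) :=
  range_projChart k i

lemma projSpaceChart_mem_coordOpen_iff (i : Fin (n + 1)) (j : Fin n)
    (y : Spec (polyRing k (Fin n))) : projSpaceChart k i y ∈ coordOpen k (i.succAbove j) ↔
      (MvPolynomial.X j : MvPolynomial (Fin n) k) ∉ PrimeSpectrum.asIdeal y :=
  projChart_mem_basicOpen_iff k i j y

lemma exists_mem_range_projSpaceChart (x : (projSpace k n).toOver.left) :
    ∃ i, x ∈ Set.range (projSpaceChart k i) :=
  exists_mem_range_projChart k x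

lemma projSpaceChart_comp_hom (i : Fin (n + 1)) :
    projSpaceChart k i ≫ (projSpace k n).toOver.hom =
      Spec.map (CommRingCat.ofHom MvPolynomial.C) :=
  projChart_toSpecZero k i

/-- The points of projective space at which one of the first `m` coordinates does not vanish. -/
def projFiltration (n m : ℕ) : (projSpace k n).toOver.left.Opens :=
  ⨆ i : {i : Fin (n + 1) // i < m}, coordOpen k i.1

variable {k}

lemma mem_projFiltration {m : ℕ} {x : (projSpace k n).toOver.left} :
    x ∈ projFiltration k n m ↔ ∃ i : Fin (n + 1), i < m ∧ x ∈ coordOpen k i := by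
  refine TopologicalSpace.Opens.mem_iSup.trans ?_
  rw [Subtype.exists]
  simp only [exists_prop]

lemma projFiltration_zero : projFiltration k n 0 = ⊥ :=
  eq_bot_iff.mpr fun _ hx ↦
    have ⟨_, hi, _⟩ := mem_projFiltration.mp hx
    absurd hi (Nat.not_lt_zero _)

lemma projFiltration_last : projFiltration k n (n + 1) = ⊤ :=
  eq_top_iff.mpr fun x _ ↦
    have ⟨i, hi⟩ := exists_mem_range_projSpaceChart k x
    mem_projFiltration.mpr ⟨i, i.2, (range_projSpaceChart k i).le hi⟩

lemma mem_projFiltration_succ {m : Fin (n + 1)} {x : (projSpace k n).toOver.left} :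
    x ∈ projFiltration k n (m + 1) ↔ x ∈ coordOpen k m ∨ x ∈ projFiltration k n m := by
  simp only [mem_projFiltration, Nat.lt_succ_iff_lt_or_eq, Fin.val_inj, or_and_right, exists_or,
    exists_eq_left, or_comm]

lemma projSpaceChart_mem_projFiltration_iff {m : Fin (n + 1)} {y : Spec (polyRing k (Fin n))} :
    projSpaceChart k m y ∈ projFiltration k n m ↔ ∃ j : Fin n, j < (m : ℕ) ∧
      (MvPolynomial.X j : MvPolynomial (Fin n) k) ∉ PrimeSpectrum.asIdeal y := by
  have hval {j : Fin n} (hj : j < (m : ℕ)) : (m.succAbove j : ℕ) = j :=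
    congrArg Fin.val (Fin.succAbove_of_castSucc_lt m j hj)
  rw [mem_projFiltration]
  constructor
  · rintro ⟨i, hi, hy⟩
    let j : Fin n := ⟨i, by omega⟩
    have hj : i = m.succAbove j := Fin.ext (hval (j := j) hi).symm
    exact ⟨j, hi, (projSpaceChart_mem_coordOpen_iff k m j y).mp (hj ▸ hy)⟩
  · rintro ⟨j, hj, hy⟩
    exact ⟨m.succAbove j, (hval hj).trans_lt hj,
      (projSpaceChart_mem_coordOpen_iff k m j y).mpr hy⟩

lemma range_coordSubspace_projSpaceChart (m : Fin (n + 1)) :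
    Set.range (coordSubspace k {j : Fin n | (m : ℕ) ≤ j} ≫ projSpaceChart k m) =
      (projFiltration k n (m + 1) : Set (projSpace k n).toOver.left) \ projFiltration k n m := by
  have hmem (y : Spec (polyRing k (Fin n))) :
      y ∈ Set.range (coordSubspace k {j : Fin n | (m : ℕ) ≤ j}) ↔
        projSpaceChart k m y ∉ projFiltration k n m := by
    rw [mem_range_coordSubspace_iff, projSpaceChart_mem_projFiltration_iff]
    simp only [Set.mem_ofPred_eq, not_le, not_exists, not_and, not_not]
  rw [Scheme.Hom.comp_base, TopCat.coe_comp, Set.range_comp]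
  ext x
  constructor
  · rintro ⟨y, hy, rfl⟩
    exact ⟨mem_projFiltration_succ.mpr (.inl ((range_projSpaceChart k m).le ⟨y, rfl⟩)),
      (hmem y).mp hy⟩
  · rintro ⟨hx, hx'⟩
    obtain ⟨y, rfl⟩ := (range_projSpaceChart k m).ge
      ((mem_projFiltration_succ.mp hx).resolve_right hx')
    exact ⟨y, (hmem y).mpr hx', rfl⟩

lemma isStratum_projFiltration (m : Fin (n + 1)) :
    (affineSpace k {j : Fin n | (m : ℕ) ≤ j}).IsStratum (projSpace k n)
      (projFiltration k n m) (projFiltration k n (m + 1)) := by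
  have h : (coordSubspace k {j : Fin n | (m : ℕ) ≤ j} ≫ projSpaceChart k m) ≫
      (projSpace k n).toOver.hom = Spec.map (CommRingCat.ofHom MvPolynomial.C) := by
    rw [Category.assoc, projSpaceChart_comp_hom, coordSubspace_comp]
  exact ⟨fun x hx ↦ mem_projFiltration_succ.mpr (.inr hx), Over.homMk _ h,
    inferInstanceAs (IsPreimmersion (coordSubspace k {j : Fin n | (m : ℕ) ≤ j} ≫
      projSpaceChart k m)), range_coordSubspace_projSpaceChart m⟩

lemma cls_projSpace (k : Type u) [Field k] (n : ℕ) :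
    K0Var.cls (projSpace k n) = ∑ i ∈ Finset.range (n + 1), lefschetz k ^ i := by
  have h := K0Var.cls_restrict_eq_sum (isStratum_projFiltration (k := k) (n := n))
  rw [projFiltration_zero, projFiltration_last, K0Var.cls_restrict_bot, K0Var.cls_restrict_top,
    zero_add] at h
  simp only [h, K0Var.cls_affineSpace_ge]
  rw [Fin.sum_univ_eq_sum_range fun m ↦ lefschetz k ^ (n - m)]
  exact Finset.sum_flip fun i ↦ lefschetz k ^ i

end ProjSpace

section RationalPoint

variable {k : Type u} [Field k] {Y : Over (Spec (.of k))}

lemma rationalPoint_comp_hom (p : RationalPoint Y) : p.left ≫ Y.hom = 𝟙 (Spec (.of k)) := Over.w p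

lemma isClosedImmersion_rationalPoint (p : RationalPoint Y) : IsClosedImmersion p.left :=
  isClosedImmersion_of_comp_eq_id (Y := Spec (.of k)) Y.hom p.left (rationalPoint_comp_hom p)

lemma rationalPoint_ext {p q : RationalPoint Y} (x : Spec (.of k))
    (h : p.left x = q.left x) : p = q := by
  have := isClosedImmersion_rationalPoint q
  have hfst : Surjective (pullback.fst p.left q.left) := ⟨fun z ↦ by
    rw [← Set.mem_range, Scheme.Pullback.range_fst, Subsingleton.elim (α := Spec (.of k)) z x]
    exact ⟨x, h.symm⟩⟩
  have : IsReduced (Over.mk (𝟙 (Spec (.of k)))).left :=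
    inferInstanceAs (IsReduced (Spec (.of k)))
  have : IsIso (pullback.fst p.left q.left) := isIso_of_isClosedImmersion_of_surjective _
  obtain ⟨e, he⟩ : ∃ e : Spec (.of k) ⟶ Spec (.of k), e ≫ q.left = p.left :=
    ⟨inv (pullback.fst p.left q.left) ≫ pullback.snd _ _, by
      rw [Category.assoc, ← pullback.condition, IsIso.inv_hom_id_assoc]⟩
  have he' : e = 𝟙 _ := calc
    e = e ≫ q.left ≫ Y.hom := by rw [rationalPoint_comp_hom, Category.comp_id]
    _ = 𝟙 _ := by rw [reassoc_of% he, rationalPoint_comp_hom]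
  exact Over.OverMorphism.ext (by rw [← he, he', Category.id_comp])

end RationalPoint

section PointChart

variable {k : Type u} [Field k] {σ : Type} {Y : Over (Spec (.of k))}

/-- An open immersion over `k` of the affine space with coordinates indexed by `σ` that sends the
origin to the rational point `p`. -/
structure PointChart (σ : Type) (p : RationalPoint Y) where
  map : Spec (polyRing k σ) ⟶ Y.left
  isOpenImmersion : IsOpenImmersion map
  comp_hom : map ≫ Y.hom = Spec.map (CommRingCat.ofHom MvPolynomial.C)
  origin_comp : Spec.map (evalOrigin k σ) ≫ map = p.left

lemma exists_specMap_comp_eq_rationalPoint (p : RationalPoint Y)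
    (c : Spec (polyRing k σ) ⟶ Y.left) [IsOpenImmersion c]
    (hc : c ≫ Y.hom = Spec.map (CommRingCat.ofHom MvPolynomial.C))
    (hp : Set.range p.left ⊆ Set.range c) :
    ∃ θ : polyRing k σ ⟶ .of k, Spec.map θ ≫ c = p.left ∧
      ∀ a : k, θ.hom (MvPolynomial.C a) = a := by
  obtain ⟨θ, hθ⟩ := Spec.map_surjective
    (R := polyRing k σ) (S := .of k) (IsOpenImmersion.lift c p.left hp)
  have h : Spec.map θ ≫ c = p.left := by rw [hθ, IsOpenImmersion.lift_fac]
  have hC : Spec.map (CommRingCat.ofHom MvPolynomial.C ≫ θ) = Spec.map (𝟙 (.of k)) := by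
    rw [Spec.map_comp, ← hc, reassoc_of% h, rationalPoint_comp_hom, Spec.map_id]
  exact ⟨θ, h, fun a ↦ congr($(Spec.map_injective hC).hom a)⟩

/-- Translation of affine space by a vector. -/
def translation {k : Type u} [CommRing k] (a : σ → k) : polyRing k σ ⟶ polyRing k σ :=
  CommRingCat.ofHom (MvPolynomial.eval₂Hom MvPolynomial.C
    fun j ↦ MvPolynomial.X j + MvPolynomial.C (a j))

section

variable {k : Type u} [CommRing k] (a : σ → k)

lemma translation_C (b : k) : (translation a).hom (MvPolynomial.C b) = MvPolynomial.C b :=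
  MvPolynomial.eval₂Hom_C _ _ b

lemma translation_X (j : σ) :
    (translation a).hom (MvPolynomial.X j) = MvPolynomial.X j + MvPolynomial.C (a j) :=
  MvPolynomial.eval₂Hom_X' _ _ j

lemma translation_comp_translation_neg : translation a ≫ translation (-a) = 𝟙 _ := by
  refine polyRing_hom_ext (fun c ↦ ?_) (fun j ↦ ?_)
  · rw [CommRingCat.hom_comp, RingHom.comp_apply, translation_C, translation_C]
    rfl
  · rw [CommRingCat.hom_comp, RingHom.comp_apply, translation_X, map_add, translation_X,
      translation_C, add_assoc, ← map_add, Pi.neg_apply, neg_add_cancel, map_zero, add_zero]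
    rfl

instance isIso_translation : IsIso (translation a) := by
  refine ⟨translation (-a), translation_comp_translation_neg a, ?_⟩
  have h := translation_comp_translation_neg (-a)
  rwa [neg_neg] at h

lemma translation_comp_evalOrigin {θ : polyRing k σ ⟶ .of k}
    (hC : ∀ b : k, θ.hom (MvPolynomial.C b) = b) :
    translation (fun j ↦ θ.hom (MvPolynomial.X j)) ≫ evalOrigin k σ = θ := by
  refine polyRing_hom_ext (fun b ↦ ?_) (fun j ↦ ?_)
  · rw [CommRingCat.hom_comp, RingHom.comp_apply, translation_C, evalOrigin_C, hC]
  · rw [CommRingCat.hom_comp, RingHom.comp_apply, translation_X, map_add, evalOrigin_X,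
      evalOrigin_C, zero_add]

lemma specMap_translation_comp : Spec.map (translation a) ≫
    Spec.map (CommRingCat.ofHom MvPolynomial.C) = Spec.map (CommRingCat.ofHom MvPolynomial.C) := by
  rw [← Spec.map_comp]
  congr 1
  exact CommRingCat.hom_ext (RingHom.ext (translation_C a))

end

lemma nonempty_pointChart_of_chart (p : RationalPoint Y) (c : Spec (polyRing k σ) ⟶ Y.left)
    [IsOpenImmersion c] (hc : c ≫ Y.hom = Spec.map (CommRingCat.ofHom MvPolynomial.C))
    (hp : Set.range p.left ⊆ Set.range c) : Nonempty (PointChart σ p) := by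
  obtain ⟨θ, hθ, hC⟩ := exists_specMap_comp_eq_rationalPoint p c hc hp
  refine ⟨⟨Spec.map (translation fun j ↦ θ.hom (MvPolynomial.X j)) ≫ c, inferInstance, ?_, ?_⟩⟩
  · rw [Category.assoc, hc, specMap_translation_comp]
  · rw [← Category.assoc, ← Spec.map_comp, translation_comp_evalOrigin hC, hθ]

lemma nonempty_pointChart_projSpace {n : ℕ} (p : RationalPoint (projSpace k n).toOver) :
    Nonempty (PointChart (Fin n) p) := by
  let x : Spec (.of k) := default
  obtain ⟨i, hi⟩ := exists_mem_range_projSpaceChart k (p.left x)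
  refine nonempty_pointChart_of_chart p (projSpaceChart k i) (projSpaceChart_comp_hom k i) ?_
  rintro _ ⟨z, rfl⟩
  rwa [Subsingleton.elim (α := Spec (.of k)) z x]

end PointChart

/-! ### The exceptional divisor -/

section OriginPoint

variable {k : Type u} [Field k] {σ : Type}

/-- The origin of affine space, as a point of the underlying topological space. -/
def originPoint (k : Type u) [Field k] (σ : Type) : Spec (polyRing k σ) :=
  Spec.map (evalOrigin k σ) (default : Spec (.of k))

lemma asIdeal_originPoint :
    PrimeSpectrum.asIdeal (originPoint k σ) = MvPolynomial.idealOfVars σ k := by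
  let z : Spec (.of k) := default
  have hbot : PrimeSpectrum.asIdeal z = ⊥ := by
    rw [Subsingleton.elim z (⟨⊥, Ideal.isPrime_bot⟩ : PrimeSpectrum k)]
  change Ideal.comap (evalOrigin k σ).hom (PrimeSpectrum.asIdeal z) = _
  rw [hbot, ← ker_constantCoeff]
  rfl

lemma eq_originPoint_iff (y : Spec (polyRing k σ)) : y = originPoint k σ ↔
    ∀ j, (MvPolynomial.X j : MvPolynomial σ k) ∈ PrimeSpectrum.asIdeal y := by
  have hle : MvPolynomial.idealOfVars σ k ≤ PrimeSpectrum.asIdeal y ↔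
      ∀ j, (MvPolynomial.X j : MvPolynomial σ k) ∈ PrimeSpectrum.asIdeal y :=
    Ideal.span_le.trans Set.range_subset_iff
  have hmax : (MvPolynomial.idealOfVars σ k).IsMaximal := by
    rw [← ker_constantCoeff]
    exact RingHom.ker_isMaximal_of_surjective _ fun a ↦
      ⟨MvPolynomial.C a, MvPolynomial.constantCoeff_C σ a⟩
  have hext : y = originPoint k σ ↔
      PrimeSpectrum.asIdeal y = MvPolynomial.idealOfVars σ k := by
    rw [← asIdeal_originPoint]
    exact PrimeSpectrum.ext_iff
  rw [← hle, hext]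
  exact ⟨ge_of_eq, fun h ↦ (hmax.eq_of_le y.2.ne_top h).symm⟩

lemma specMap_chartHom_eq_originPoint_iff [DecidableEq σ] (i : σ) (y : Spec (polyRing k σ)) :
    Spec.map (chartHom k i) y = originPoint k σ ↔
      (MvPolynomial.X i : MvPolynomial σ k) ∈ PrimeSpectrum.asIdeal y := by
  rw [eq_originPoint_iff]
  change (∀ j, (chartHom k i).hom (MvPolynomial.X j) ∈ PrimeSpectrum.asIdeal y) ↔ _
  refine ⟨fun h ↦ chartHom_X_self (k := k) i ▸ h i, fun h j ↦ ?_⟩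
  by_cases hj : j = i
  · rwa [hj, chartHom_X_self]
  · rw [chartHom_X_of_ne hj]
    exact Ideal.mul_mem_right _ _ h

end OriginPoint

section ExceptionalCell

namespace IsLocalBlowUp

variable {k : Type u} [Field k] {σ : Type}
  {V : (Spec (polyRing k σ)).Opens} {X : Scheme.{u}} {f : X ⟶ Spec (polyRing k σ)}

lemma apply_chart [DecidableEq σ] (H : IsLocalBlowUp V f) (i : σ)
    (y : (chartOpens V i).toScheme) :
    f (H.chart i y) = Spec.map (chartHom k i) ((chartOpens V i).ι y) := by
  rw [← Scheme.Hom.comp_apply, H.chart_comp, Scheme.Hom.comp_apply]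

variable [LinearOrder σ] (H : IsLocalBlowUp V f) (hV : originPoint k σ ∈ V) (i : σ)

include hV in
lemma range_coordSubspace_subset_chartOpens :
    Set.range (coordSubspace k (Set.Ioi i)) ⊆ Set.range (chartOpens V i).ι := by
  intro y hy
  rw [mem_range_coordSubspace_iff] at hy
  have hy₀ := (specMap_chartHom_eq_originPoint_iff i y).mpr (hy i (lt_irrefl i))
  rw [Scheme.Opens.range_ι]
  change Spec.map (chartHom k i) y ∈ V
  rwa [hy₀]

/-- The linear subspace of the `i`-th chart on which the coordinates with index at most `i`
vanish. -/
def cellInChart : Spec (polyRing k (Set.Ioi i)) ⟶ (chartOpens V i).toScheme :=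
  IsOpenImmersion.lift (chartOpens V i).ι (coordSubspace k (Set.Ioi i))
    (range_coordSubspace_subset_chartOpens hV i)

lemma cellInChart_comp : cellInChart hV i ≫ (chartOpens V i).ι = coordSubspace k (Set.Ioi i) :=
  IsOpenImmersion.lift_fac _ _ _

instance isPreimmersion_cellInChart : IsPreimmersion (cellInChart hV i) := by
  have : IsPreimmersion (cellInChart hV i ≫ (chartOpens V i).ι) := by
    rw [cellInChart_comp]
    infer_instance
  exact IsPreimmersion.of_comp _ (chartOpens V i).ι

lemma mem_range_cellInChart_iff (y : (chartOpens V i).toScheme) :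
    y ∈ Set.range (cellInChart hV i) ↔ ∀ j ≤ i,
      (MvPolynomial.X j : MvPolynomial σ k) ∈ PrimeSpectrum.asIdeal ((chartOpens V i).ι y) := by
  rw [range_eq_preimage_range_comp _ (chartOpens V i).ι.isOpenEmbedding.injective,
    cellInChart_comp, Set.mem_preimage, mem_range_coordSubspace_iff]
  simp only [Set.mem_Ioi, not_lt]

/-- The part of the exceptional divisor that lies in the `i`-th chart but in none of the previous
ones; it is an affine space with coordinates indexed by the `j > i`. -/
def exceptionalCell : Spec (polyRing k (Set.Ioi i)) ⟶ X :=
  cellInChart hV i ≫ H.chart i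

instance isPreimmersion_exceptionalCell : IsPreimmersion (H.exceptionalCell hV i) :=
  inferInstanceAs (IsPreimmersion (cellInChart hV i ≫ H.chart i))

lemma exceptionalCell_comp :
    H.exceptionalCell hV i ≫ f ≫ Spec.map (CommRingCat.ofHom MvPolynomial.C) =
      Spec.map (CommRingCat.ofHom MvPolynomial.C) := by
  have hC : CommRingCat.ofHom MvPolynomial.C ≫ chartHom k i = CommRingCat.ofHom MvPolynomial.C :=
    CommRingCat.hom_ext (RingHom.ext (chartHom_C i))
  rw [exceptionalCell, Category.assoc, reassoc_of% H.chart_comp, reassoc_of% cellInChart_comp,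
    ← Spec.map_comp, hC, coordSubspace_comp]

lemma mem_range_exceptionalCell_iff (x : X) : x ∈ Set.range (H.exceptionalCell hV i) ↔
    f x = originPoint k σ ∧ x ∈ Set.range (H.chart i) ∧ ∀ l < i, x ∉ Set.range (H.chart l) := by
  have hchart (y : (chartOpens V i).toScheme) : y ∈ Set.range (cellInChart hV i) ↔
      f (H.chart i y) = originPoint k σ ∧ ∀ l < i, H.chart i y ∉ Set.range (H.chart l) := by
    rw [mem_range_cellInChart_iff, H.apply_chart, specMap_chartHom_eq_originPoint_iff]
    refine ⟨fun h ↦ ⟨h i le_rfl, fun l hl ↦ ?_⟩, fun ⟨h₀, h⟩ l hl ↦ ?_⟩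
    · rw [H.chart_mem_range_chart_iff hl.ne, not_not]
      exact h l hl.le
    · obtain rfl | hlt := hl.eq_or_lt
      · exact h₀
      · rw [← not_not (a := _ ∈ _), ← H.chart_mem_range_chart_iff hlt.ne]
        exact h l hlt
  rw [exceptionalCell, Scheme.Hom.comp_base, TopCat.coe_comp, Set.range_comp]
  constructor
  · rintro ⟨y, hy, rfl⟩
    exact ⟨((hchart y).mp hy).1, ⟨y, rfl⟩, ((hchart y).mp hy).2⟩
  · rintro ⟨h₀, ⟨y, rfl⟩, h⟩
    exact ⟨y, (hchart y).mpr ⟨h₀, h⟩, rfl⟩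

end IsLocalBlowUp

end ExceptionalCell

section PointImage

variable {k : Type u} [Field k] {Y : Over (Spec (.of k))}

/-- The point of the underlying topological space given by a rational point. -/
def pointImage (p : RationalPoint Y) : Y.left := p.left (default : Spec (.of k))

lemma pointImage_injective : Function.Injective (pointImage (Y := Y)) :=
  fun _ _ ↦ rationalPoint_ext _

lemma range_rationalPoint (p : RationalPoint Y) : Set.range p.left = {pointImage p} :=
  @Set.range_unique _ (Spec (.of k)) p.left _

lemma isClosed_singleton_pointImage (p : RationalPoint Y) : IsClosed {pointImage p} := by
  have := isClosedImmersion_rationalPoint p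
  rw [← range_rationalPoint]
  exact p.left.isClosedEmbedding.isClosed_range

lemma PointChart.map_originPoint {σ : Type} {p : RationalPoint Y} (c : PointChart σ p) :
    c.map (originPoint k σ) = pointImage p := by
  rw [originPoint, ← Scheme.Hom.comp_apply, c.origin_comp]
  rfl

/-- The complement of the members with index in `S` of a finite family of rational points. -/
def awayFrom {ι : Type*} [Finite ι] (p : ι → RationalPoint Y) (S : Set ι) : Y.left.Opens :=
  ⟨(⋃ i ∈ S, {pointImage (p i)})ᶜ, (S.toFinite.isClosed_biUnion
    fun i _ ↦ isClosed_singleton_pointImage (p i)).isOpen_compl⟩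

lemma mem_awayFrom {ι : Type*} [Finite ι] {p : ι → RationalPoint Y} {S : Set ι} {y : Y.left} :
    y ∈ awayFrom p S ↔ ∀ i ∈ S, y ≠ pointImage (p i) := by
  change y ∈ (⋃ i ∈ S, {pointImage (p i)})ᶜ ↔ _
  simp only [Set.mem_compl_iff, Set.mem_iUnion, Set.mem_singleton_iff, exists_prop, not_exists,
    not_and, ne_eq]

end PointImage

/-! ### Blow-ups at rational points -/

section Centre

variable {k : Type u} [Field k] {σ : Type} {N : ℕ} {Y : Over (Spec (.of k))}
  {p : Fin N → RationalPoint Y}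

/-- The part of the affine chart around the `i`-th point that avoids the other points. -/
def chartDomain (c : ∀ i, PointChart σ (p i)) (i : Fin N) : (Spec (polyRing k σ)).Opens :=
  (c i).map ⁻¹ᵁ awayFrom p {i}ᶜ

lemma mem_chartDomain {c : ∀ i, PointChart σ (p i)} {i : Fin N} {y : Spec (polyRing k σ)} :
    y ∈ chartDomain c i ↔ ∀ j ≠ i, (c i).map y ≠ pointImage (p j) :=
  mem_awayFrom

lemma originPoint_mem_chartDomain (hp : Function.Injective p) (c : ∀ i, PointChart σ (p i))
    (i : Fin N) : originPoint k σ ∈ chartDomain c i :=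
  mem_chartDomain.mpr fun j hj ↦ by
    rw [(c i).map_originPoint]
    exact fun h ↦ hj (hp (pointImage_injective h)).symm

lemma comap_ker_rationalPoint_eq_top {T : Scheme.{u}} (q : RationalPoint Y) (f : T ⟶ Y.left)
    (h : ∀ t, f t ≠ pointImage q) : q.left.ker.comap f = ⊤ := by
  have := isClosedImmersion_rationalPoint q
  refine comap_ker_eq_top_of_disjoint q.left f fun t ↦ ?_
  rw [range_rationalPoint]
  exact h t

lemma idealOfPoints_comap_awayFrom :
    (idealOfPoints p).comap (awayFrom p Set.univ).ι = ⊤ := by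
  rw [idealOfPoints, comap_iInf_of_isOpenImmersion, iInf_eq_top]
  exact fun i ↦ comap_ker_rationalPoint_eq_top _ _ fun t ↦ mem_awayFrom.mp t.2 i trivial

lemma PointChart.ker_comap {q : RationalPoint Y} (c : PointChart σ q) :
    q.left.ker.comap c.map = originIdeal k σ := by
  have := c.isOpenImmersion
  have := isClosedImmersion_rationalPoint q
  have : QuasiCompact (Spec.map (evalOrigin k σ) ≫ c.map) := by
    rw [c.origin_comp]
    exact inferInstanceAs (QuasiCompact q.left)
  rw [← c.origin_comp, ker_comp_comap_of_isOpenImmersion, ker_specMap_evalOrigin]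

lemma idealOfPoints_comap_chartDomain (c : ∀ i, PointChart σ (p i)) (i : Fin N) :
    (idealOfPoints p).comap ((chartDomain c i).ι ≫ (c i).map) =
      (originIdeal k σ).comap (chartDomain c i).ι := by
  have := (c i).isOpenImmersion
  have hi : (p i).left.ker.comap ((chartDomain c i).ι ≫ (c i).map) =
      (originIdeal k σ).comap (chartDomain c i).ι := by
    rw [Scheme.IdealSheafData.comap_comp, (c i).ker_comap]
  have hne (j : Fin N) (hj : j ≠ i) :
      (p j).left.ker.comap ((chartDomain c i).ι ≫ (c i).map) = ⊤ :=
    comap_ker_rationalPoint_eq_top (p j) _ fun t ↦ by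
      rw [Scheme.Hom.comp_apply]
      exact mem_chartDomain.mp t.2 j hj
  rw [idealOfPoints, comap_iInf_of_isOpenImmersion]
  refine le_antisymm ((iInf_le _ i).trans hi.le) (le_iInf fun j ↦ ?_)
  obtain rfl | hj := eq_or_ne j i
  · exact hi.ge
  · exact le_top.trans (hne j hj).ge

/-- The open cover of `Y` by the complement of the points and by a neighbourhood of each point. -/
def centreCover (c : ∀ i, PointChart σ (p i)) : Option (Fin N) → Y.left.Opens
  | none => awayFrom p Set.univ
  | some i => have := (c i).isOpenImmersion; (c i).map ''ᵁ chartDomain c i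

lemma pointImage_mem_centreCover (hp : Function.Injective p) (c : ∀ i, PointChart σ (p i))
    (i : Fin N) : pointImage (p i) ∈ centreCover c (some i) :=
  ⟨originPoint k σ, originPoint_mem_chartDomain hp c i, (c i).map_originPoint⟩

lemma ne_pointImage_of_mem_centreCover {c : ∀ i, PointChart σ (p i)} {i j : Fin N} (hj : j ≠ i)
    {y : Y.left} (hy : y ∈ centreCover c (some i)) : y ≠ pointImage (p j) := by
  obtain ⟨z, hz, rfl⟩ := hy
  exact mem_chartDomain.mp hz j hj

lemma isOpenCover_centreCover (hp : Function.Injective p) (c : ∀ i, PointChart σ (p i)) :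
    TopologicalSpace.IsOpenCover (centreCover c) := by
  refine eq_top_iff.mpr fun y _ ↦ TopologicalSpace.Opens.mem_iSup.mpr ?_
  by_cases hy : ∃ i, y = pointImage (p i)
  · obtain ⟨i, rfl⟩ := hy
    exact ⟨some i, pointImage_mem_centreCover hp c i⟩
  · exact ⟨none, mem_awayFrom.mpr fun i _ h ↦ hy ⟨i, h⟩⟩

variable {X : Over (Spec (.of k))}

/-- The restriction of `π` over the affine chart around the `i`-th point. -/
def overChart (c : ∀ i, PointChart σ (p i)) (π : X ⟶ Y) (i : Fin N) :
    (π.left ⁻¹ᵁ centreCover c (some i)).toScheme ⟶ Spec (polyRing k σ) :=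
  have := (c i).isOpenImmersion
  restrictChart (c i).map (chartDomain c i) π.left

lemma overChart_comp (c : ∀ i, PointChart σ (p i)) (π : X ⟶ Y) (i : Fin N) :
    overChart c π i ≫ (c i).map = (π.left ⁻¹ᵁ centreCover c (some i)).ι ≫ π.left :=
  have := (c i).isOpenImmersion
  restrictChart_comp (c i).map (chartDomain c i) π.left

lemma overChart_comp_specMap_C (c : ∀ i, PointChart σ (p i)) (π : X ⟶ Y) (i : Fin N) :
    overChart c π i ≫ Spec.map (CommRingCat.ofHom MvPolynomial.C) =
      (π.left ⁻¹ᵁ centreCover c (some i)).ι ≫ X.hom := by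
  rw [← (c i).comp_hom, reassoc_of% overChart_comp c π i, Over.w]

lemma morphismRestrict_centreCover_ι (c : ∀ i, PointChart σ (p i)) (π : X ⟶ Y) (i : Fin N) :
    π.left ∣_ centreCover c (some i) ≫ (centreCover c (some i)).ι =
      overChart c π i ≫ (c i).map := by
  rw [morphismRestrict_ι, overChart_comp]

lemma overChart_eq_originPoint_iff (c : ∀ i, PointChart σ (p i)) (π : X ⟶ Y) (i : Fin N)
    (x : (π.left ⁻¹ᵁ centreCover c (some i)).toScheme) :
    overChart c π i x = originPoint k σ ↔
      π.left ((π.left ⁻¹ᵁ centreCover c (some i)).ι x) = pointImage (p i) := by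
  have := (c i).isOpenImmersion
  rw [← Scheme.Hom.comp_apply, ← overChart_comp, Scheme.Hom.comp_apply, ← (c i).map_originPoint]
  exact (c i).map.isOpenEmbedding.injective.eq_iff.symm

namespace IsBlowUp

variable {π : X ⟶ Y}

lemma isLocalBlowUp_overChart (h : IsBlowUp π.left (idealOfPoints p))
    (c : ∀ i, PointChart σ (p i)) (i : Fin N) :
    IsLocalBlowUp (chartDomain c i) (overChart c π i) :=
  have := (c i).isOpenImmersion
  h.isLocalBlowUp (c i).map (idealOfPoints_comap_chartDomain c i)

lemma isIso_morphismRestrict_awayFrom (h : IsBlowUp π.left (idealOfPoints p)) :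
    IsIso (π.left ∣_ awayFrom p Set.univ) :=
  h.isIso_morphismRestrict _ idealOfPoints_comap_awayFrom

lemma isSeparated_of_pointCharts [Finite σ] (h : IsBlowUp π.left (idealOfPoints p))
    (hp : Function.Injective p) (c : ∀ i, PointChart σ (p i)) : IsSeparated π.left := by
  classical
  refine IsZariskiLocalAtTarget.of_iSup_eq_top (P := @IsSeparated) (centreCover c)
    (isOpenCover_centreCover hp c) fun i ↦ ?_
  match i with
  | none =>
    have : IsIso (π.left ∣_ centreCover c none) := h.isIso_morphismRestrict_awayFrom
    infer_instance
  | some i =>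
    have := (c i).isOpenImmersion
    have := (h.isLocalBlowUp_overChart c i).isSeparated
    have : IsSeparated (π.left ∣_ centreCover c (some i) ≫ (centreCover c (some i)).ι) := by
      rw [morphismRestrict_centreCover_ι]
      infer_instance
    exact IsSeparated.of_comp _ (centreCover c (some i)).ι

lemma locallyOfFiniteType_of_pointCharts [Finite σ] (h : IsBlowUp π.left (idealOfPoints p))
    (hp : Function.Injective p) (c : ∀ i, PointChart σ (p i)) : LocallyOfFiniteType π.left := by
  classical
  refine IsZariskiLocalAtTarget.of_iSup_eq_top (P := @LocallyOfFiniteType) (centreCover c)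
    (isOpenCover_centreCover hp c) fun i ↦ ?_
  match i with
  | none =>
    have : IsIso (π.left ∣_ centreCover c none) := h.isIso_morphismRestrict_awayFrom
    infer_instance
  | some i =>
    have := (c i).isOpenImmersion
    have := (h.isLocalBlowUp_overChart c i).locallyOfFiniteType
    have : LocallyOfFiniteType (π.left ∣_ centreCover c (some i) ≫ (centreCover c (some i)).ι) := by
      rw [morphismRestrict_centreCover_ι]
      infer_instance
    exact locallyOfFiniteType_of_comp _ (centreCover c (some i)).ι

end IsBlowUp

end Centre

section IsVariety

variable {k : Type u} [Field k] {σ : Type} [Finite σ] {N : ℕ} {Y : Variety k}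
  {p : Fin N → RationalPoint Y.toOver} {X : Over (Spec (.of k))} {π : X ⟶ Y.toOver}

namespace IsBlowUp

lemma isVariety_of_pointCharts (h : IsBlowUp π.left (idealOfPoints p))
    (hp : Function.Injective p) (c : ∀ i, PointChart σ (p i)) : IsVariety X := by
  classical
  obtain ⟨_, _, _, -⟩ := Y.isVariety
  have := Y.isNoetherian
  have := h.isSeparated_of_pointCharts hp c
  have := h.locallyOfFiniteType_of_pointCharts hp c
  have hw : π.left ≫ Y.toOver.hom = X.hom := Over.w π
  have hU : IsIso (π.left ∣_ centreCover c none) := h.isIso_morphismRestrict_awayFrom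
  have hcover : TopologicalSpace.IsOpenCover fun i ↦ π.left ⁻¹ᵁ centreCover c i :=
    (isOpenCover_centreCover hp c).comap π.left.base.hom
  let 𝒰 : Scheme.OpenCover.{0} X.left := X.left.openCoverOfIsOpenCover _ hcover
  have : Finite 𝒰.I₀ := inferInstanceAs (Finite (Option (Fin N)))
  have (i : 𝒰.I₀) : IsReduced (𝒰.X i) := by
    match i with
    | none =>
      have := isReduced_of_isOpenImmersion (centreCover c none).ι
      change IsReduced (π.left ⁻¹ᵁ centreCover c none).toScheme
      exact isReduced_of_isOpenImmersion (π.left ∣_ centreCover c none)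
    | some i => exact (h.isLocalBlowUp_overChart c i).isReduced
  have (i : 𝒰.I₀) : CompactSpace (𝒰.X i) := by
    match i with
    | none =>
      have : CompactSpace (centreCover c none).toScheme :=
        isCompact_iff_compactSpace.mp (TopologicalSpace.NoetherianSpace.isCompact _)
      exact (π.left ∣_ centreCover c none).homeomorph.symm.compactSpace
    | some i => exact (h.isLocalBlowUp_overChart c i).compactSpace
  have hX : LocallyOfFiniteType X.hom := hw ▸ inferInstance
  exact isVariety_of_openCover 𝒰 (fun _ ↦ inferInstance) (hw ▸ inferInstance)

end IsBlowUp

end IsVariety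

section AwayFromGe

variable {k : Type u} [Field k] {N : ℕ}

/-- The complement of the points with index at least `m`. -/
def awayFromGe {Y : Over (Spec (.of k))} (p : Fin N → RationalPoint Y) (m : ℕ) : Y.left.Opens :=
  awayFrom p {j | m ≤ j}

section

variable {Y : Over (Spec (.of k))} {p : Fin N → RationalPoint Y}

lemma mem_awayFromGe {m : ℕ} {y : Y.left} :
    y ∈ awayFromGe p m ↔ ∀ j : Fin N, m ≤ j → y ≠ pointImage (p j) :=
  mem_awayFrom

lemma awayFromGe_zero : awayFromGe p 0 = awayFrom p Set.univ := by
  simp only [awayFromGe, Nat.zero_le, Set.ofPred_true]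

lemma awayFromGe_last : awayFromGe p N = ⊤ :=
  eq_top_iff.mpr fun _ _ ↦ mem_awayFromGe.mpr fun j hj ↦ absurd j.2 hj.not_gt

lemma mem_awayFromGe_iff {i : Fin N} {y : Y.left} :
    y ∈ awayFromGe p i ↔ y ≠ pointImage (p i) ∧ y ∈ awayFromGe p (i + 1) := by
  simp only [mem_awayFromGe, Nat.add_one_le_iff]
  simp only [le_iff_eq_or_lt, or_imp, forall_and, Fin.val_inj, forall_eq']

lemma awayFromGe_le (i : Fin N) : awayFromGe p i ≤ awayFromGe p (i + 1) :=
  fun _ hy ↦ (mem_awayFromGe_iff.mp hy).2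

lemma pointImage_mem_awayFromGe (hp : Function.Injective p) (i : Fin N) :
    pointImage (p i) ∈ awayFromGe p (i + 1) :=
  mem_awayFromGe.mpr fun _ hj h ↦
    (Nat.lt_of_succ_le hj).ne congr(($(hp (pointImage_injective h)) : ℕ))

lemma centreCover_le_awayFromGe {σ : Type} (c : ∀ i, PointChart σ (p i)) (i : Fin N) :
    centreCover c (some i) ≤ awayFromGe p (i + 1) :=
  fun _ hy ↦ mem_awayFromGe.mpr fun _ hj ↦
    ne_pointImage_of_mem_centreCover (Fin.ne_of_gt hj) hy

end

variable {Y : Variety k} {p : Fin N → RationalPoint Y.toOver}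

lemma isStratum_rationalPoint (hp : Function.Injective p) (i : Fin N) :
    (Variety.spec k k).IsStratum Y (awayFromGe p i) (awayFromGe p (i + 1)) := by
  have := isClosedImmersion_rationalPoint (p i)
  have hw : (p i).left ≫ Y.toOver.hom = Spec.map (CommRingCat.ofHom (algebraMap k k)) :=
    (rationalPoint_comp_hom (p i)).trans (Spec.map_id _).symm
  refine ⟨awayFromGe_le i, Over.homMk (p i).left hw,
    inferInstanceAs (IsPreimmersion (p i).left), ?_⟩
  change Set.range (p i).left = _
  ext y
  rw [range_rationalPoint, Set.mem_sdiff, SetLike.mem_coe, SetLike.mem_coe, mem_awayFromGe_iff,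
    Set.mem_singleton_iff]
  constructor
  · rintro rfl
    exact ⟨pointImage_mem_awayFromGe hp i, fun h ↦ h.1 rfl⟩
  · rintro ⟨hy, hy'⟩
    by_contra hne
    exact hy' ⟨hne, hy⟩

lemma K0Var.cls_eq_cls_awayFrom_add (hp : Function.Injective p) :
    cls Y = cls (Y.restrict (awayFrom p Set.univ)) + N := by
  have h := cls_restrict_eq_sum (isStratum_rationalPoint hp)
  rwa [awayFromGe_last, awayFromGe_zero, cls_restrict_top, Finset.sum_const, cls_spec_self,
    Finset.card_univ, Fintype.card_fin, nsmul_one] at h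

end AwayFromGe

section BlowUpFiltration

variable {k : Type u} [Field k] {n N : ℕ} {Y X : Variety k} {p : Fin N → RationalPoint Y.toOver}
  {π : X.toOver ⟶ Y.toOver}

namespace IsBlowUp

section LocalChart

variable (h : IsBlowUp π.left (idealOfPoints p)) (c : ∀ i, PointChart (Fin n) (p i)) (i : Fin N)
  (a : Fin n)

/-- The charts of the blow-up around the `i`-th point. -/
def localChart : (chartOpens (chartDomain c i) a).toScheme ⟶ X.toOver.left :=
  (h.isLocalBlowUp_overChart c i).chart a ≫ (π.left ⁻¹ᵁ centreCover c (some i)).ι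

instance isOpenImmersion_localChart : IsOpenImmersion (h.localChart c i a) :=
  inferInstanceAs (IsOpenImmersion
    ((h.isLocalBlowUp_overChart c i).chart a ≫ (π.left ⁻¹ᵁ centreCover c (some i)).ι))

lemma mem_range_localChart_iff (x : (π.left ⁻¹ᵁ centreCover c (some i)).toScheme) :
    (π.left ⁻¹ᵁ centreCover c (some i)).ι x ∈ Set.range (h.localChart c i a) ↔
      x ∈ Set.range ((h.isLocalBlowUp_overChart c i).chart a) := by
  rw [range_eq_preimage_range_comp ((h.isLocalBlowUp_overChart c i).chart a)
    (π.left ⁻¹ᵁ centreCover c (some i)).ι.isOpenEmbedding.injective]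
  rfl

lemma mem_centreCover_of_mem_range_localChart {x : X.toOver.left}
    (hx : x ∈ Set.range (h.localChart c i a)) : π.left x ∈ centreCover c (some i) := by
  obtain ⟨y, rfl⟩ := hx
  rw [localChart, Scheme.Hom.comp_apply]
  exact ((h.isLocalBlowUp_overChart c i).chart a y).2

variable (hp : Function.Injective p)

/-- The cells of the exceptional divisor over the `i`-th point. -/
def localCell : Spec (polyRing k (Set.Ioi a)) ⟶ X.toOver.left :=
  (h.isLocalBlowUp_overChart c i).exceptionalCell (originPoint_mem_chartDomain hp c i) a ≫
    (π.left ⁻¹ᵁ centreCover c (some i)).ι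

instance isPreimmersion_localCell : IsPreimmersion (h.localCell c i a hp) :=
  inferInstanceAs (IsPreimmersion
    ((h.isLocalBlowUp_overChart c i).exceptionalCell (originPoint_mem_chartDomain hp c i) a ≫
      (π.left ⁻¹ᵁ centreCover c (some i)).ι))

lemma localCell_comp_hom :
    h.localCell c i a hp ≫ X.toOver.hom = Spec.map (CommRingCat.ofHom MvPolynomial.C) := by
  rw [localCell, Category.assoc, ← overChart_comp_specMap_C,
    IsLocalBlowUp.exceptionalCell_comp]

lemma mem_range_localCell_iff (x : X.toOver.left) : x ∈ Set.range (h.localCell c i a hp) ↔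
    π.left x = pointImage (p i) ∧ x ∈ Set.range (h.localChart c i a) ∧
      ∀ l < a, x ∉ Set.range (h.localChart c i l) := by
  have hcell (w : (π.left ⁻¹ᵁ centreCover c (some i)).toScheme) :=
    ((h.isLocalBlowUp_overChart c i).mem_range_exceptionalCell_iff
      (originPoint_mem_chartDomain hp c i) a w).trans <|
        and_congr (overChart_eq_originPoint_iff c π i w) <|
          and_congr (h.mem_range_localChart_iff c i a w).symm <|
            forall₂_congr fun l _ ↦ not_congr (h.mem_range_localChart_iff c i l w).symm
  rw [localCell, Scheme.Hom.comp_base, TopCat.coe_comp, Set.range_comp]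
  constructor
  · rintro ⟨w, hw, rfl⟩
    exact (hcell w).mp hw
  · intro hx
    obtain ⟨w, rfl⟩ : x ∈ Set.range (π.left ⁻¹ᵁ centreCover c (some i)).ι := by
      rw [Scheme.Opens.range_ι]
      exact h.mem_centreCover_of_mem_range_localChart c i a hx.2.1
    exact ⟨w, (hcell w).mpr hx, rfl⟩

end LocalChart

variable (h : IsBlowUp π.left (idealOfPoints p)) (c : ∀ i, PointChart (Fin n) (p i)) (i : Fin N)

/-- The open subset lying over the complement of the points with index at least `i`, together with
the first `b` charts around the `i`-th point. -/
def blowUpFiltration (b : ℕ) : X.toOver.left.Opens :=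
  π.left ⁻¹ᵁ awayFromGe p i ⊔ ⨆ a : {a : Fin n // a < b}, (h.localChart c i a.1).opensRange

variable {h c i}

lemma mem_blowUpFiltration {b : ℕ} {x : X.toOver.left} : x ∈ h.blowUpFiltration c i b ↔
    π.left x ∈ awayFromGe p i ∨ ∃ a : Fin n, a < b ∧ x ∈ Set.range (h.localChart c i a) := by
  refine or_congr Iff.rfl (TopologicalSpace.Opens.mem_iSup.trans ?_)
  exact ⟨fun ⟨⟨a, ha⟩, hx⟩ ↦ ⟨a, ha, hx⟩, fun ⟨a, ha, hx⟩ ↦ ⟨⟨a, ha⟩, hx⟩⟩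

lemma mem_blowUpFiltration_succ {a : Fin n} {x : X.toOver.left} :
    x ∈ h.blowUpFiltration c i (a + 1) ↔
      x ∈ Set.range (h.localChart c i a) ∨ x ∈ h.blowUpFiltration c i a := by
  simp only [mem_blowUpFiltration, Nat.lt_succ_iff_lt_or_eq, Fin.val_inj, or_and_right, exists_or,
    exists_eq_left]
  rw [← or_assoc, or_comm]

variable (h c i)

lemma blowUpFiltration_zero : h.blowUpFiltration c i 0 = π.left ⁻¹ᵁ awayFromGe p i := by
  refine TopologicalSpace.Opens.ext (Set.ext fun x ↦ ?_)
  rw [SetLike.mem_coe, mem_blowUpFiltration]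
  simp only [Nat.not_lt_zero, false_and, exists_false, or_false]
  rfl

lemma blowUpFiltration_last (hp : Function.Injective p) :
    h.blowUpFiltration c i n = π.left ⁻¹ᵁ awayFromGe p (i + 1) := by
  refine le_antisymm (fun x hx ↦ ?_) (fun x (hx : π.left x ∈ awayFromGe p (i + 1)) ↦ ?_)
  · obtain hx | ⟨a, -, hx⟩ := mem_blowUpFiltration.mp hx
    · exact awayFromGe_le (p := p) i hx
    · exact centreCover_le_awayFromGe c i (h.mem_centreCover_of_mem_range_localChart c i a hx)
  · refine mem_blowUpFiltration.mpr (or_iff_not_imp_left.mpr fun hx' ↦ ?_)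
    have hxi : π.left x = pointImage (p i) :=
      by_contra fun hne ↦ hx' (mem_awayFromGe_iff.mpr ⟨hne, hx⟩)
    obtain ⟨w, rfl⟩ : x ∈ Set.range (π.left ⁻¹ᵁ centreCover c (some i)).ι := by
      rw [Scheme.Opens.range_ι]
      change π.left x ∈ centreCover c (some i)
      rw [hxi]
      exact pointImage_mem_centreCover hp c i
    obtain ⟨a, ha⟩ := (h.isLocalBlowUp_overChart c i).exists_mem_range_chart w
    exact ⟨a, a.2, (h.mem_range_localChart_iff c i a w).mpr ha⟩

lemma range_localCell (hp : Function.Injective p) (a : Fin n) :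
    Set.range (h.localCell c i a hp) =
      (h.blowUpFiltration c i (a + 1) : Set X.toOver.left) \ h.blowUpFiltration c i a := by
  have hpoint {x : X.toOver.left} (hx : x ∈ Set.range (h.localChart c i a)) :
      π.left x = pointImage (p i) ↔ π.left x ∉ awayFromGe p i := by
    have := centreCover_le_awayFromGe c i (h.mem_centreCover_of_mem_range_localChart c i a hx)
    rw [mem_awayFromGe_iff, and_iff_left this, not_not]
  ext x
  rw [mem_range_localCell_iff, Set.mem_sdiff, SetLike.mem_coe, SetLike.mem_coe,
    mem_blowUpFiltration_succ, or_and_right, and_not_self_iff, or_false, and_left_comm]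
  refine and_congr_right fun hx ↦ ?_
  rw [hpoint hx, mem_blowUpFiltration, not_or]
  simp only [not_exists, not_and, Fin.val_fin_lt]

lemma isStratum_blowUpFiltration (hp : Function.Injective p) (a : Fin n) :
    (affineSpace k (Set.Ioi a)).IsStratum X (h.blowUpFiltration c i a)
      (h.blowUpFiltration c i (a + 1)) :=
  ⟨fun _ hx ↦ mem_blowUpFiltration_succ.mpr (.inr hx),
    Over.homMk (h.localCell c i a hp) (h.localCell_comp_hom c i a hp),
    inferInstanceAs (IsPreimmersion (h.localCell c i a hp)), h.range_localCell c i hp a⟩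

include h c in
lemma cls_restrict_preimage_awayFromGe_succ (hp : Function.Injective p) :
    K0Var.cls (X.restrict (π.left ⁻¹ᵁ awayFromGe p (i + 1))) =
      K0Var.cls (X.restrict (π.left ⁻¹ᵁ awayFromGe p i)) +
        ∑ a ∈ Finset.range n, lefschetz k ^ a := by
  have hsum := K0Var.cls_restrict_eq_sum (h.isStratum_blowUpFiltration c i hp)
  simp only [K0Var.cls_affineSpace, Nat.card_eq_fintype_card, Fintype.card_Ioi,
    Fin.card_Ioi] at hsum
  rw [← h.blowUpFiltration_last c i hp, hsum, blowUpFiltration_zero,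
    Fin.sum_univ_eq_sum_range fun a ↦ lefschetz k ^ (n - 1 - a),
    Finset.sum_range_reflect fun a ↦ lefschetz k ^ a]

omit i in
include h c in
lemma cls_restrict_preimage_awayFromGe (hp : Function.Injective p) {m : ℕ} (hm : m ≤ N) :
    K0Var.cls (X.restrict (π.left ⁻¹ᵁ awayFromGe p m)) =
      K0Var.cls (X.restrict (π.left ⁻¹ᵁ awayFrom p Set.univ)) +
        m * ∑ a ∈ Finset.range n, lefschetz k ^ a := by
  induction m with
  | zero => rw [awayFromGe_zero, Nat.cast_zero, zero_mul, add_zero]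
  | succ m ih =>
    rw [h.cls_restrict_preimage_awayFromGe_succ c ⟨m, hm⟩ hp, ih (Nat.le_of_succ_le hm),
      Nat.cast_succ]
    ring

include h in
lemma cls_restrict_preimage_awayFrom :
    K0Var.cls (X.restrict (π.left ⁻¹ᵁ awayFrom p Set.univ)) =
      K0Var.cls (Y.restrict (awayFrom p Set.univ)) := by
  have := h.isIso_morphismRestrict_awayFrom
  let e : (π.left ⁻¹ᵁ awayFrom p Set.univ).toScheme ≅ (awayFrom p Set.univ).toScheme :=
    asIso (π.left ∣_ awayFrom p Set.univ)
  refine K0Var.cls_eq_of_iso (Over.isoMk e ?_)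
  change π.left ∣_ awayFrom p Set.univ ≫ (awayFrom p Set.univ).ι ≫ Y.toOver.hom =
    (π.left ⁻¹ᵁ awayFrom p Set.univ).ι ≫ X.toOver.hom
  rw [morphismRestrict_ι_assoc, Over.w]

include h c in
theorem cls_add_eq (hp : Function.Injective p) :
    K0Var.cls X + N = K0Var.cls Y + N * ∑ a ∈ Finset.range n, lefschetz k ^ a := by
  have hX := h.cls_restrict_preimage_awayFromGe c hp le_rfl
  have htop : K0Var.cls (X.restrict (π.left ⁻¹ᵁ ⊤)) = K0Var.cls X := K0Var.cls_restrict_top X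
  rw [awayFromGe_last, htop] at hX
  rw [hX, h.cls_restrict_preimage_awayFrom, K0Var.cls_eq_cls_awayFrom_add hp]
  ring

end IsBlowUp

end BlowUpFiltration

section ProjSpaceBlowUp

variable {k : Type u} [Field k] {n N : ℕ}

lemma IsBlowUp.exists_isVariety_cls_eq {p : Fin N → RationalPoint (projSpace k n).toOver}
    {X : Over (Spec (.of k))} {π : X ⟶ (projSpace k n).toOver}
    (h : IsBlowUp π.left (idealOfPoints p)) (hp : Function.Injective p) :
    ∃ hX : IsVariety X, K0Var.cls ⟨X, hX⟩ = ∑ i ∈ Finset.range (n + 1), lefschetz k ^ i +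
      N * (∑ i ∈ Finset.range n, lefschetz k ^ i - 1) := by
  have c (i) : PointChart (Fin n) (p i) := (nonempty_pointChart_projSpace (p i)).some
  have hX : IsVariety X := h.isVariety_of_pointCharts hp c
  have hcls := cls_add_eq (X := ⟨X, hX⟩) h c hp
  refine ⟨hX, ?_⟩
  rw [cls_projSpace] at hcls
  linear_combination hcls

lemma LEquivalent.of_cls_eq {X Y : Variety k} (h : K0Var.cls X = K0Var.cls Y) :
    LEquivalent X Y := by
  rw [LEquivalent, h, sub_self, map_zero]

end ProjSpaceBlowUp

theorem mainTheorem1_general (k : Type u) [Field k] (n N : ℕ) :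
    (∀ (p : Fin N → RationalPoint (projSpace k n).toOver) (_ : Function.Injective p)
        (X : Over (Spec (.of k))) (π : X ⟶ (projSpace k n).toOver)
        (_ : IsBlowUp π.left (idealOfPoints p)),
      ∃ hX : IsVariety X, K0Var.cls ⟨X, hX⟩ = ∑ i ∈ Finset.range (n + 1), lefschetz k ^ i +
        N * (∑ i ∈ Finset.range n, lefschetz k ^ i - 1)) ∧
    (∀ (p q : Fin N → RationalPoint (projSpace k n).toOver)
        (_ : Function.Injective p) (_ : Function.Injective q) (X Y : Over (Spec (.of k)))
        (π : X ⟶ (projSpace k n).toOver) (ρ : Y ⟶ (projSpace k n).toOver)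
        (_ : IsBlowUp π.left (idealOfPoints p)) (_ : IsBlowUp ρ.left (idealOfPoints q)),
      ∃ (hX : IsVariety X) (hY : IsVariety Y),
        K0Var.cls ⟨X, hX⟩ = K0Var.cls ⟨Y, hY⟩ ∧ LEquivalent ⟨X, hX⟩ ⟨Y, hY⟩) := by
  refine ⟨fun p hp X π h ↦ h.exists_isVariety_cls_eq hp, fun p q hp hq X Y π ρ h h' ↦ ?_⟩
  obtain ⟨hX, eX⟩ := h.exists_isVariety_cls_eq hp
  obtain ⟨hY, eY⟩ := h'.exists_isVariety_cls_eq hq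
  have hXY := eX.trans eY.symm
  exact ⟨hX, hY, hXY, .of_cls_eq hXY⟩

theorem mainTheorem1 (k : Type u) [Field k] [CharZero k] :
    -- the class of the blow-up at 8 distinct points is given by a formula without `p`
    (∀ (p : Fin 8 → RationalPoint (projectiveThreeSpace k)) (_ : Function.Injective p)
        (X : Over (Spec (.of k))) (π : X ⟶ projectiveThreeSpace k)
        (_ : IsBlowUp π.left (idealOfPoints p)),
      ∃ hX : IsVariety X,
        K0Var.cls ⟨X, hX⟩ = lefschetz k ^ 3 + 9 * lefschetz k ^ 2 + 9 * lefschetz k + 1) ∧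
    -- any two such blow-ups have the same class and are L-equivalent
    (∀ (p q : Fin 8 → RationalPoint (projectiveThreeSpace k))
        (_ : Function.Injective p) (_ : Function.Injective q)
        (X Y : Over (Spec (.of k)))
        (π : X ⟶ projectiveThreeSpace k) (ρ : Y ⟶ projectiveThreeSpace k)
        (_ : IsBlowUp π.left (idealOfPoints p)) (_ : IsBlowUp ρ.left (idealOfPoints q)),
      ∃ (hX : IsVariety X) (hY : IsVariety Y),
        K0Var.cls ⟨X, hX⟩ = K0Var.cls ⟨Y, hY⟩ ∧ LEquivalent ⟨X, hX⟩ ⟨Y, hY⟩) := by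
  refine ⟨fun p hp X π h ↦ ?_, (mainTheorem1_general k 3 8).2⟩
  obtain ⟨hX, e⟩ := (mainTheorem1_general k 3 8).1 p hp X π h
  refine ⟨hX, e.trans ?_⟩
  norm_num [Finset.sum_range_succ]
  ring

end
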